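/- Let $n\ge 1$ and $0<\alpha<n$. For a set $E\subset\mathbb R^n$ write $E(\epsilon)=\{x:\operatorname{dist}(x,E)<\epsilon\}$ and let $\mathcal M^{*\alpha}(E)=\limsup_{\epsilon\to0+}(2\epsilon)^{\alpha-n}|E(\epsilon)|$ be the $\alpha$-dimensional upper Minkowski content. Let $M\subset\mathbb R^n$ be compact, let $\mu\neq0$ be a finite Borel measure with $\mu(\mathbb R^n\setminus M)=0$, and let $A\ge 0$ be a constant such that $$\mathcal M^{*\alpha}(S)\neq0\quad\text{and}\quad \mathcal M^{*\alpha}(S)\le A\,\mu(S)\qquad\text{for every compact } S\subset M \text{ with } \mu(S)\neq0 .$$ Let $u$ be a (complex) tempered distribution on $\mathbb R^n$ whose support is contained in $M$. Then the Fourier transform $\widehat u$ is a continuous function; put $\sigma_u(r)=\int_{S^{n-1}}|\widehat u(r\omega)|^2\,d\omega$, where $d\omega$ is the surface measure. For $1\le r<2$ and $\frac1r+\frac1s=1$ let $$\|u\|_r=\sup\{|\langle u,\psi\rangle|:\psi\in C_c^\infty(\mathbb R^n),\ \|\psi\|_{L^{s}(\mathbb R^n)}\le1\}.$$ All quantities below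 take values in $[0,\infty]$. (a) If $2\le p<\frac{2n}{\alpha}$, then $$\|u\|_1^p\le C\,(A\mu(M))^{p/2}\limsup_{L\to\infty}\frac1{L^{n-\alpha p/2}}\int_0^L\sigma_u(r)^{p/2}r^{n-1}\,dr\le C'\,(A\mu(M))^{p/2}\limsup_{L\to\infty}\frac1{L^{n-\alpha p/2}}\int_{|\xi|<L}|\widehat u(\xi)|^p\,d\xi ,$$ where $C,C'\in(0,\infty)$ depend only on $n,\alpha,p$. (b) More generally, if $1<q\le\infty$, $2\le p<\frac{2n}{\alpha+\frac{n-\alpha}{q}}$, $\frac1r+\frac1{2q}=1$ and $k=n-\frac{\alpha p}2-(n-\alpha)\frac p{2q}$, then $$\|u\|_r^p\le C\,(A\mu(M))^{\frac p2(1-\frac1q)}\limsup_{L\to\infty}\frac1{L^{k}}\int_0^L\sigma_u(t)^{p/2}t^{n-1}\,dt\le C'\,(A\mu(M))^{\frac p2(1-\frac1q)}\limsup_{L\to\infty}\frac1{L^{k}}\int_{|\xi|<L}|\widehat u(\xi)|^p\,d\xi ,$$ where $C,C'\in(0,\infty)$ depend only on $n,\alpha,p,q$. -/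

import Mathlib

open MeasureTheory Filter Topology Set
open scoped ENNReal NNReal SchwartzMap FourierTransform

noncomputable section

/-- `ℝⁿ` with its Euclidean norm. -/
abbrev Rn (n : ℕ) : Type := EuclideanSpace ℝ (Fin n)

/-- The `s`-dimensional upper Minkowski content `limsup_{ε → 0+} (2ε)^(s-n) |A(ε)|`, where
`A(ε)` is the set of points at distance less than `ε` from `A`. -/
def upperMinkowskiContent {n : ℕ} (s : ℝ) (A : Set (Rn n)) : ℝ≥0∞ :=
  limsup (fun ε : ℝ =>
    ENNReal.ofReal ((2 * ε) ^ (s - (n : ℝ))) * volume (Metric.thickening ε A)) (𝓝[>] 0)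

/-- The `α`-dimensional upper Minkowski content of every compact `S ⊆ M` of non-zero `μ`-measure
is non-zero and bounded above by `A * μ S`. -/
def MinkowskiBounded {n : ℕ} (α : ℝ) (A : ℝ≥0) (M : Set (Rn n)) (μ : Measure (Rn n)) : Prop :=
  ∀ S : Set (Rn n), S ⊆ M → IsCompact S → μ S ≠ 0 →
    upperMinkowskiContent α S ≠ 0 ∧ upperMinkowskiContent α S ≤ A * μ S

/-- The Fourier transform of the tempered distribution `u` is the continuous function `g`.
Such a `g` is unique. -/
def IsFourierFunction {n : ℕ} (u : 𝓢'(Rn n, ℂ)) (g : Rn n → ℂ) : Prop :=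
  Continuous g ∧ ∀ φ : 𝓢(Rn n, ℂ),
    Integrable (fun ξ => g ξ * φ ξ) volume ∧ (𝓕 u) φ = ∫ ξ, g ξ * φ ξ

/-- `σ(r) = ∫_{S^{n-1}} |g(rω)|² dω`, for the surface measure of the unit sphere. -/
def sphericalMean {n : ℕ} (g : Rn n → ℂ) (r : ℝ) : ℝ≥0∞ :=
  ∫⁻ ω : Metric.sphere (0 : Rn n) 1, ‖g (r • (ω : Rn n))‖ₑ ^ 2
    ∂((volume : Measure (Rn n)).toSphere)

/-- `sup {|⟨u, ψ⟩| : ψ ∈ C_c^∞(ℝⁿ), ‖ψ‖_{L^s} ≤ 1}`. With `1/r + 1/s = 1` this is the norm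
written `‖u‖_r`. The compactly supported smooth functions are the compactly supported Schwartz
functions. -/
def dualNorm {n : ℕ} (u : 𝓢'(Rn n, ℂ)) (s : ℝ≥0∞) : ℝ≥0∞ :=
  ⨆ (ψ : 𝓢(Rn n, ℂ)) (_ : HasCompactSupport ψ) (_ : eLpNorm ψ s volume ≤ 1), ‖u ψ‖ₑ

/-- `limsup_{L → ∞} L^(-k) ∫_0^L σ(r)^(p/2) r^(n-1) dr`. -/
def radialLimsup {n : ℕ} (g : Rn n → ℂ) (p k : ℝ) : ℝ≥0∞ :=
  limsup (fun L : ℝ => ENNReal.ofReal (L ^ (-k)) *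
    ∫⁻ r in Ioo (0 : ℝ) L,
      sphericalMean g r ^ (p / 2) * ENNReal.ofReal (r ^ ((n : ℝ) - 1))) atTop

/-- `limsup_{L → ∞} L^(-k) ∫_{|ξ| < L} |g(ξ)|^p dξ`. -/
def ballLimsup {n : ℕ} (g : Rn n → ℂ) (p k : ℝ) : ℝ≥0∞ :=
  limsup (fun L : ℝ => ENNReal.ofReal (L ^ (-k)) *
    ∫⁻ ξ in Metric.ball (0 : Rn n) L, ‖g ξ‖ₑ ^ p) atTop

end

/-!
Let `g` be the Fourier transform of `u` and mollify `u` at scale `ε` by a bump `χ`. The mollified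
distribution lives within distance `ε` of `M` and has Fourier transform `g · χ̂(ε ·)`, so by
Cauchy–Schwarz and Plancherel the square of its pairing with `ψ` is at most
`∫ |g|² |χ̂(ε ·)|² · ∫_{M(ε)} |ψ|²`. Hölder's inequality in polar coordinates turns a bound
`∫_0^L σ(r)^(p/2) r^(n-1) dr ≤ K L^k` into a bound `∫_{|ξ| < L} |g|² ≤ K^(2/p) L^m`, and summing
over dyadic balls bounds the first factor by a multiple of `K^(2/p) ε^(-m)`. The second factor is
at most `|M(ε)|^(1 - 1/q)`, and the Minkowski content of `M` bounds it by a multiple of `ε^m`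
for the same `m = (n - α)(1 - 1/q)`. The powers of `ε` cancel, and `ε → 0` gives the estimate.
Jensen's inequality on the sphere compares the radial integrals with those over balls.

That `𝓕 u` is a continuous function: if `χ = 1` near `M` then `u = χu`, so `|u (𝓕 φ)|` is at most a
weighted `L¹` norm of `φ`. A heavier weight gives an `L²` bound, hence a density for `𝓕 u` by Riesz
representation, and convolution with `𝓕⁻ χ`, which does not change `𝓕 u`, makes it continuous.
-/

section Support

open Distribution
open scoped ContDiff Manifold

variable {V : Type*} [NormedAddCommGroup V] [InnerProductSpace ℝ V]

theorem hasTemperateGrowth_comp_smul (η : 𝓢(V, ℂ)) (ε : ℝ) :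
    (fun x => η (ε • x)).HasTemperateGrowth :=
  η.hasTemperateGrowth.comp (g := η) (ε • ContinuousLinearMap.id ℝ V).hasTemperateGrowth

theorem pow_mul_norm_iteratedFDeriv_mul_le {f g : V → ℂ} (hf : ContDiff ℝ ∞ f)
    (hg : ContDiff ℝ ∞ g) {x : V} {k l : ℕ} {a b : ℕ → ℝ}
    (ha : ∀ i ≤ l, ‖iteratedFDeriv ℝ i f x‖ ≤ a i)
    (hb : ∀ i ≤ l, ‖x‖ ^ k * ‖iteratedFDeriv ℝ i g x‖ ≤ b i) :
    ‖x‖ ^ k * ‖iteratedFDeriv ℝ l (fun y => f y * g y) x‖ ≤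
      ∑ i ∈ Finset.range (l + 1), l.choose i * a i * b (l - i) := by
  calc ‖x‖ ^ k * ‖iteratedFDeriv ℝ l (fun y => f y * g y) x‖
      ≤ ‖x‖ ^ k * ∑ i ∈ Finset.range (l + 1),
          l.choose i * ‖iteratedFDeriv ℝ i f x‖ * ‖iteratedFDeriv ℝ (l - i) g x‖ := by
        gcongr
        exact norm_iteratedFDeriv_mul_le hf hg x (by exact_mod_cast le_top)
    _ = ∑ i ∈ Finset.range (l + 1), l.choose i * ‖iteratedFDeriv ℝ i f x‖ *
          (‖x‖ ^ k * ‖iteratedFDeriv ℝ (l - i) g x‖) := by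
        rw [Finset.mul_sum]
        exact Finset.sum_congr rfl fun i _ => by ring
    _ ≤ _ := by
        refine Finset.sum_le_sum fun i hi => ?_
        have hil : i ≤ l := Nat.lt_succ_iff.1 (Finset.mem_range.1 hi)
        have ha0 : 0 ≤ a i := (norm_nonneg _).trans (ha i hil)
        gcongr
        exacts [ha i hil, hb _ (Nat.sub_le _ _)]

theorem norm_iteratedFDeriv_comp_smul_le (η : 𝓢(V, ℂ)) {ε : ℝ} (hε : 0 ≤ ε) (hε1 : ε ≤ 1) (i : ℕ)
    (x : V) :
    ‖iteratedFDeriv ℝ i (fun y => η (ε • y)) x‖ ≤ SchwartzMap.seminorm ℝ 0 i η := by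
  rw [iteratedFDeriv_comp_const_smul ε (η.smooth i), norm_smul, norm_pow, Real.norm_of_nonneg hε]
  exact (mul_le_of_le_one_left (norm_nonneg _) (pow_le_one₀ hε hε1)).trans
    (SchwartzMap.norm_iteratedFDeriv_le_seminorm ℝ η i (ε • x))

theorem pow_mul_norm_iteratedFDeriv_le_of_one_le (φ : 𝓢(V, ℂ)) {ε : ℝ} (hε : 0 ≤ ε) {x : V}
    (hx : 1 ≤ ε * ‖x‖) (k j : ℕ) :
    ‖x‖ ^ k * ‖iteratedFDeriv ℝ j φ x‖ ≤ ε * SchwartzMap.seminorm ℝ (k + 1) j φ :=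
  calc ‖x‖ ^ k * ‖iteratedFDeriv ℝ j φ x‖
      ≤ (ε * ‖x‖) * (‖x‖ ^ k * ‖iteratedFDeriv ℝ j φ x‖) :=
        le_mul_of_one_le_left (by positivity) hx
    _ = ε * (‖x‖ ^ (k + 1) * ‖iteratedFDeriv ℝ j φ x‖) := by ring
    _ ≤ _ := by
        gcongr
        exact SchwartzMap.le_seminorm ℝ (k + 1) j φ x

theorem exists_seminorm_smulLeftCLM_comp_smul_sub_le {η : 𝓢(V, ℂ)} (hη : ∀ x, ‖x‖ < 1 → η x = 1)
    (φ : 𝓢(V, ℂ)) (k l : ℕ) : ∃ C : ℝ, ∀ ε : ℝ, 0 ≤ ε → ε ≤ 1 →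
      SchwartzMap.seminorm ℝ k l (SchwartzMap.smulLeftCLM ℂ (fun x => η (ε • x)) φ - φ) ≤
        ε * C := by
  let a : ℕ → ℝ := fun i => SchwartzMap.seminorm ℝ 0 i η
  let b : ℕ → ℝ := fun j => SchwartzMap.seminorm ℝ (k + 1) j φ
  refine ⟨∑ i ∈ Finset.range (l + 1), l.choose i * a i * b (l - i) + b l, fun ε hε hε1 =>
    SchwartzMap.seminorm_le_bound ℝ k l _ (by positivity) fun x => ?_⟩
  have hT := hasTemperateGrowth_comp_smul η ε
  have hcoe : ⇑(SchwartzMap.smulLeftCLM ℂ (fun x => η (ε • x)) φ - φ) =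
      (fun y => η (ε • y) * φ y) - ⇑φ := by
    ext y
    simp [SchwartzMap.smulLeftCLM_apply_apply hT]
  rw [hcoe]
  rcases lt_or_ge (ε * ‖x‖) 1 with hx | hx
  · have hev : (fun y => η (ε • y) * φ y) - ⇑φ =ᶠ[𝓝 x] 0 := by
      have hcont : Continuous fun y : V => ε * ‖y‖ := by fun_prop
      filter_upwards [hcont.continuousAt.eventually_lt continuousAt_const hx] with y hy
      simp [hη (ε • y) (by rwa [norm_smul, Real.norm_of_nonneg hε])]
    rw [(hev.iteratedFDeriv ℝ l).eq_of_nhds]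
    simp only [Pi.zero_def, iteratedFDeriv_fun_zero, norm_zero, mul_zero]
    positivity
  · have hφ := pow_mul_norm_iteratedFDeriv_le_of_one_le φ hε hx k
    have hprod := pow_mul_norm_iteratedFDeriv_mul_le hT.1 (φ.smooth ⊤)
      (fun i _ => norm_iteratedFDeriv_comp_smul_le η hε hε1 i x) (l := l) (fun j _ => hφ j)
    rw [iteratedFDeriv_sub_apply
      (((hT.1.mul (φ.smooth ⊤)).of_le (by exact_mod_cast le_top)).contDiffAt)
      (φ.smooth l).contDiffAt]
    calc _ ≤ ‖x‖ ^ k * (‖iteratedFDeriv ℝ l (fun y => η (ε • y) * φ y) x‖ +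
            ‖iteratedFDeriv ℝ l φ x‖) := by
          gcongr
          exact norm_sub_le _ _
      _ ≤ ∑ i ∈ Finset.range (l + 1), l.choose i * a i * (ε * b (l - i)) + ε * b l := by
          rw [mul_add]
          exact add_le_add hprod (hφ l)
      _ = _ := by
          simp only [mul_add, Finset.mul_sum, mul_left_comm]

theorem tendsto_smulLeftCLM_comp_smul {η : 𝓢(V, ℂ)} (hη : ∀ x, ‖x‖ < 1 → η x = 1) (φ : 𝓢(V, ℂ)) :
    Tendsto (fun ε : ℝ => SchwartzMap.smulLeftCLM ℂ (fun x => η (ε • x)) φ) (𝓝[>] 0) (𝓝 φ) := by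
  rw [(schwartz_withSeminorms ℝ V ℂ).tendsto_nhds]
  rintro ⟨k, l⟩ δ hδ
  obtain ⟨C, hC⟩ := exists_seminorm_smulLeftCLM_comp_smul_sub_le hη φ k l
  have hlim : Tendsto (fun ε : ℝ => ε * C) (𝓝[>] 0) (𝓝 0) := by
    simpa using (tendsto_id.mul_const C).mono_left (nhdsWithin_le_nhds (a := (0 : ℝ)))
  filter_upwards [hlim.eventually (gt_mem_nhds hδ), Ioc_mem_nhdsGT (zero_lt_one' ℝ)] with ε hεC hε
  exact (hC ε hε.1.le hε.2).trans_lt hεC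

variable [FiniteDimensional ℝ V]

theorem exists_schwartz_eq_one_nhdsSet {M U : Set V} (hM : IsClosed M) (hU : IsOpen U)
    (hUb : Bornology.IsBounded U) (hMU : M ⊆ U) :
    ∃ χ : 𝓢(V, ℂ), HasCompactSupport χ ∧ (∀ᶠ x in 𝓝ˢ M, χ x = 1) ∧ (∀ x ∉ U, χ x = 0) ∧
      ∀ x, ‖χ x‖ ≤ 1 := by
  obtain ⟨f, h1, h0, h01⟩ := exists_contMDiffMap_one_nhds_of_subset_interior (n := ⊤) 𝓘(ℝ, V) hM
    (hU.interior_eq.symm ▸ hMU)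
  have hc : HasCompactSupport (fun x => (f x : ℂ)) :=
    HasCompactSupport.intro hUb.isCompact_closure fun x hx => by
      rw [h0 x fun h => hx (subset_closure h), Complex.ofReal_zero]
  have hsm : ContDiff ℝ ∞ (fun x => (f x : ℂ)) :=
    Complex.ofRealCLM.contDiff.comp f.contMDiff.contDiff
  refine ⟨hc.toSchwartzMap hsm, hc, ?_, ?_, ?_⟩
  · filter_upwards [h1] with x hx
    simp [hx]
  · intro x hx
    simp [h0 x hx]
  · intro x
    simpa [abs_of_nonneg (h01 x).1] using (h01 x).2

theorem apply_eq_zero_of_tsupport_subset_compl_dsupport {u : 𝓢'(V, ℂ)} {φ : 𝓢(V, ℂ)}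
    (hφ : HasCompactSupport φ) (h : tsupport φ ⊆ (dsupport u)ᶜ) : u φ = 0 := by
  choose U hUv hUo hUx using fun x : tsupport φ => (notMem_dsupport_iff (x : V)).1 (h x.2)
  obtain ⟨f, hf⟩ := SmoothPartitionOfUnity.exists_isSubordinate 𝓘(ℝ, V) (isClosed_tsupport φ) U hUo
    fun x hx => mem_iUnion.2 ⟨⟨x, hx⟩, hUx _⟩
  have hfin : {i | (Function.support (f i) ∩ tsupport φ).Nonempty}.Finite :=
    f.locallyFinite.finite_nonempty_inter_compact hφ
  have hcs : ∀ i, HasCompactSupport (fun x => (f i x : ℂ) * φ x) := fun i => hφ.mul_left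
  have hsm : ∀ i, ContDiff ℝ ∞ (fun x => (f i x : ℂ) * φ x) := fun i =>
    (Complex.ofRealCLM.contDiff.comp (f i).contMDiff.contDiff).mul (φ.smooth ⊤)
  let F : tsupport φ → 𝓢(V, ℂ) := fun i => (hcs i).toSchwartzMap (hsm i)
  have hsum : φ = ∑ i ∈ hfin.toFinset, F i := by
    ext x
    rw [sum_apply]
    change φ x = ∑ i ∈ hfin.toFinset, (f i x : ℂ) * φ x
    by_cases hx : x ∈ tsupport φ
    · have hone := f.sum_eq_one hx
      rw [finsum_eq_sum_of_support_subset (s := hfin.toFinset) _ fun i hi => by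
        simpa using ⟨x, hi, hx⟩] at hone
      rw [← Finset.sum_mul, ← Complex.ofReal_sum, hone, Complex.ofReal_one, one_mul]
    · simp [image_eq_zero_of_notMem_tsupport hx]
  rw [hsum, map_sum]
  refine Finset.sum_eq_zero fun i _ => hUv i _ ((closure_mono fun x hx => ?_).trans (hf i))
  have hne : (f i x : ℂ) * φ x ≠ 0 := hx
  exact Complex.ofReal_ne_zero.1 (left_ne_zero_of_mul hne)

theorem isVanishingOn_compl_dsupport (u : 𝓢'(V, ℂ)) : IsVanishingOn u (dsupport u)ᶜ := by
  intro φ hφ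
  obtain ⟨η, hηc, hη1, -, -⟩ := exists_schwartz_eq_one_nhdsSet (V := V)
    (Metric.isClosed_closedBall (x := 0) (ε := 1)) Metric.isOpen_ball Metric.isBounded_ball
    (Metric.closedBall_subset_ball one_lt_two)
  have hη : ∀ x, ‖x‖ < 1 → η x = 1 := fun x hx =>
    hη1.self_of_nhdsSet x (mem_closedBall_zero_iff.2 hx.le)
  refine tendsto_nhds_unique (((u.continuous.tendsto φ).comp
    (tendsto_smulLeftCLM_comp_smul hη φ)).congr' ?_) tendsto_const_nhds
  filter_upwards [self_mem_nhdsWithin] with ε hε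
  have hcoe := SchwartzMap.smulLeftCLM_apply (F := ℂ)
    (hasTemperateGrowth_comp_smul η ε) φ
  refine apply_eq_zero_of_tsupport_subset_compl_dsupport ?_ ?_
  · rw [hcoe]
    exact (hηc.comp_homeomorph (Homeomorph.smulOfNeZero ε (ne_of_gt hε))).smul_right
  · rw [hcoe]
    exact (tsupport_smul_subset_right _ φ).trans hφ

theorem apply_eq_of_eventuallyEq_nhdsSet {u : 𝓢'(V, ℂ)} {M : Set V} (hu : dsupport u ⊆ M)
    {φ ψ : 𝓢(V, ℂ)} (h : ∀ᶠ x in 𝓝ˢ M, φ x = ψ x) : u φ = u ψ := by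
  rw [← sub_eq_zero, ← map_sub]
  refine isVanishingOn_compl_dsupport u _ fun x hx hxu => ?_
  refine notMem_tsupport_iff_eventuallyEq.2 ?_ hx
  filter_upwards [h.filter_mono (nhds_le_nhdsSet (hu hxu))] with y hy
  simp [hy]

theorem apply_smulLeftCLM_eq {u : 𝓢'(V, ℂ)} {M : Set V} (hu : dsupport u ⊆ M) {χ : 𝓢(V, ℂ)}
    (hχ : ∀ᶠ x in 𝓝ˢ M, χ x = 1) (φ : 𝓢(V, ℂ)) : u (SchwartzMap.smulLeftCLM ℂ χ φ) = u φ := by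
  refine apply_eq_of_eventuallyEq_nhdsSet hu ?_
  filter_upwards [hχ] with x hx
  rw [SchwartzMap.smulLeftCLM_apply_apply χ.hasTemperateGrowth, hx, one_smul]

end Support

section JapaneseBracket

variable {V : Type*} [NormedAddCommGroup V]

/-- The power `⟨x⟩^(2s)` of the Japanese bracket `⟨x⟩ = (1 + |x|²)^(1/2)`, the weight in which
polynomial growth is measured. -/
noncomputable def bracketPow (s : ℝ) (x : V) : ℝ := (1 + ‖x‖ ^ 2) ^ s

theorem bracketPow_pos (s : ℝ) (x : V) : 0 < bracketPow s x := by
  unfold bracketPow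
  positivity

theorem bracketPow_add (s t : ℝ) (x : V) :
    bracketPow (s + t) x = bracketPow s x * bracketPow t x :=
  Real.rpow_add (by positivity) s t

theorem continuous_bracketPow (s : ℝ) : Continuous (bracketPow s : V → ℝ) := by
  refine Continuous.rpow_const (by fun_prop) fun x => Or.inl ?_
  positivity

theorem norm_pow_le_bracketPow {j : ℕ} {s : ℝ} (hj : j ≤ s) (x : V) :
    ‖x‖ ^ j ≤ bracketPow s x := by
  have h : ‖x‖ ≤ 1 + ‖x‖ ^ 2 := by nlinarith [sq_nonneg (‖x‖ - 1), norm_nonneg x]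
  calc ‖x‖ ^ j ≤ (1 + ‖x‖ ^ 2) ^ j := by gcongr
    _ = bracketPow j x := (Real.rpow_natCast _ _).symm
    _ ≤ bracketPow s x := Real.rpow_le_rpow_of_exponent_le (by simp) hj

theorem bracketPow_le_two_rpow_mul {s : ℝ} (hs : 0 ≤ s) (x y : V) :
    bracketPow s x ≤ 2 ^ s * bracketPow s (x - y) * bracketPow s y := by
  unfold bracketPow
  rw [← Real.mul_rpow (by positivity) (by positivity),
    ← Real.mul_rpow (by positivity) (by positivity)]
  refine Real.rpow_le_rpow (by positivity) ?_ hs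
  have h : ‖x‖ ≤ ‖x - y‖ + ‖y‖ := by simpa using norm_add_le (x - y) y
  nlinarith [sq_nonneg (‖x - y‖ - ‖y‖), sq_nonneg (‖x - y‖ * ‖y‖),
    pow_le_pow_left₀ (norm_nonneg x) h 2]

theorem memLp_two_bracketPow_neg [NormedSpace ℝ V] [FiniteDimensional ℝ V] [MeasurableSpace V]
    [BorelSpace V] (μ : Measure V) [μ.IsAddHaarMeasure] {s : ℝ}
    (hs : Module.finrank ℝ V < 4 * s) : MemLp (bracketPow (-s) : V → ℝ) 2 μ := by
  rw [memLp_two_iff_integrable_sq (continuous_bracketPow _).aestronglyMeasurable]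
  refine (integrable_rpow_neg_one_add_norm_sq (μ := μ) hs).congr (Eventually.of_forall fun x => ?_)
  simp only [sq, ← bracketPow_add]
  rw [bracketPow]
  ring_nf

variable [InnerProductSpace ℝ V]

/-- Multiplication of a Schwartz function by `⟨x⟩^(2s)`. -/
noncomputable def bracketMul (s : ℝ) : 𝓢(V, ℂ) →L[ℂ] 𝓢(V, ℂ) :=
  SchwartzMap.smulLeftCLM ℂ fun x => (bracketPow s x : ℂ)

theorem bracketMul_apply (s : ℝ) (φ : 𝓢(V, ℂ)) (x : V) :
    bracketMul s φ x = bracketPow s x * φ x := by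
  have h : (fun x : V => (((1 + ‖x‖ ^ 2) ^ s : ℝ) : ℂ)).HasTemperateGrowth := by fun_prop
  exact SchwartzMap.smulLeftCLM_apply_apply h φ x

theorem norm_bracketMul_apply (s : ℝ) (φ : 𝓢(V, ℂ)) (x : V) :
    ‖bracketMul s φ x‖ = bracketPow s x * ‖φ x‖ := by
  rw [bracketMul_apply, norm_mul, Complex.norm_real, Real.norm_of_nonneg (bracketPow_pos s x).le]

theorem bracketMul_bracketMul (s t : ℝ) (φ : 𝓢(V, ℂ)) :
    bracketMul s (bracketMul t φ) = bracketMul (s + t) φ := by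
  ext x
  simp only [bracketMul_apply, bracketPow_add, Complex.ofReal_mul, mul_assoc]

theorem bracketMul_zero (φ : 𝓢(V, ℂ)) : bracketMul 0 φ = φ := by
  ext x
  simp [bracketMul_apply, bracketPow]

theorem exists_bracketPow_mul_norm_le (s : ℝ) (φ : 𝓢(V, ℂ)) :
    ∃ D : ℝ, 0 ≤ D ∧ ∀ x, bracketPow s x * ‖φ x‖ ≤ D :=
  ⟨SchwartzMap.seminorm ℝ 0 0 (bracketMul s φ), apply_nonneg _ _, fun x =>
    norm_bracketMul_apply s φ x ▸ SchwartzMap.norm_le_seminorm ℝ (bracketMul s φ) x⟩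

theorem integrable_bracketPow_mul_norm [FiniteDimensional ℝ V] [MeasurableSpace V] [BorelSpace V]
    (s : ℝ) (φ : 𝓢(V, ℂ)) : Integrable fun x => bracketPow s x * ‖φ x‖ := by
  simpa only [norm_bracketMul_apply] using (bracketMul s φ).integrable.norm

end JapaneseBracket

section WeightedIntegral

open SchwartzMap

variable {V : Type*} [NormedAddCommGroup V] [InnerProductSpace ℝ V] [FiniteDimensional ℝ V]
  [MeasurableSpace V] [BorelSpace V]

theorem norm_iteratedFDeriv_fourier_le (φ : 𝓢(V, ℂ)) {j : ℕ} {s : ℝ} (hj : j ≤ s) (x : V) :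
    ‖iteratedFDeriv ℝ j (𝓕 φ : 𝓢(V, ℂ)) x‖ ≤
      (2 * Real.pi) ^ j * ∫ ξ, bracketPow s ξ * ‖φ ξ‖ := by
  rw [fourier_coe, Real.iteratedFDeriv_fourier (N := ⊤)
    (fun n _ => φ.integrable_pow_mul volume n) φ.continuous.aestronglyMeasurable le_top]
  refine (VectorFourier.norm_fourierIntegral_le_integral_norm _ _ _ _ _).trans ?_
  rw [← integral_const_mul]
  refine integral_mono_of_nonneg (Eventually.of_forall fun _ => norm_nonneg _)
    ((integrable_bracketPow_mul_norm s φ).const_mul _) (Eventually.of_forall fun ξ => ?_)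
  have hnorm : 2 * Real.pi * ‖innerSL ℝ (E := V)‖ ≤ 2 * Real.pi :=
    mul_le_of_le_one_right (by positivity) (norm_innerSL_le ℝ)
  calc _ ≤ (2 * Real.pi * ‖innerSL ℝ (E := V)‖) ^ j * ‖ξ‖ ^ j * ‖φ ξ‖ :=
        VectorFourier.norm_fourierPowSMulRight_le _ _ _ _
    _ ≤ (2 * Real.pi) ^ j * bracketPow s ξ * ‖φ ξ‖ := by
        gcongr
        exact norm_pow_le_bracketPow hj ξ
    _ = _ := mul_assoc _ _ _

theorem exists_seminorm_smul_fourier_le (χ : 𝓢(V, ℂ)) (k : ℕ) {l : ℕ} {s : ℝ} (hl : l ≤ s) :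
    ∃ C : ℝ, 0 ≤ C ∧ ∀ φ : 𝓢(V, ℂ),
      SchwartzMap.seminorm ℂ k l (smulLeftCLM ℂ χ (𝓕 φ)) ≤ C * ∫ ξ, bracketPow s ξ * ‖φ ξ‖ := by
  refine ⟨∑ i ∈ Finset.range (l + 1), l.choose i * (2 * Real.pi) ^ i *
    SchwartzMap.seminorm ℂ k (l - i) χ, by positivity, fun φ => ?_⟩
  have hI : 0 ≤ ∫ ξ, bracketPow s ξ * ‖φ ξ‖ :=
    integral_nonneg fun ξ => mul_nonneg (bracketPow_pos s ξ).le (norm_nonneg _)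
  refine seminorm_le_bound ℂ k l _ (by positivity) fun x => ?_
  have hcoe : ⇑(smulLeftCLM ℂ χ (𝓕 φ)) = fun y => (𝓕 φ : 𝓢(V, ℂ)) y * χ y := by
    ext y
    rw [smulLeftCLM_apply_apply χ.hasTemperateGrowth, smul_eq_mul, mul_comm]
  rw [hcoe, Finset.sum_mul]
  refine (pow_mul_norm_iteratedFDeriv_mul_le ((𝓕 φ : 𝓢(V, ℂ)).smooth ⊤) (χ.smooth ⊤)
    (fun i hi => norm_iteratedFDeriv_fourier_le φ (le_trans (by exact_mod_cast hi) hl) x)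
    fun i _ => le_seminorm ℂ k i χ x).trans_eq ?_
  exact Finset.sum_congr rfl fun i _ => by ring

theorem exists_norm_apply_smul_fourier_le (u : 𝓢'(V, ℂ)) (χ : 𝓢(V, ℂ)) :
    ∃ s C : ℝ, 0 ≤ s ∧ 0 ≤ C ∧ ∀ φ : 𝓢(V, ℂ),
      ‖u (smulLeftCLM ℂ χ (𝓕 φ))‖ ≤ C * ∫ ξ, bracketPow s ξ * ‖φ ξ‖ := by
  obtain ⟨t, C, -, hC⟩ := Seminorm.bound_of_continuous (schwartz_withSeminorms ℂ V ℂ)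
    ((normSeminorm ℂ ℂ).comp (u : 𝓢(V, ℂ) →ₗ[ℂ] ℂ)) (continuous_norm.comp u.continuous)
  let s : ℝ := (t.sup Prod.snd : ℕ)
  choose D hD0 hD using fun i : t => exists_seminorm_smul_fourier_le χ i.1.1 (s := s)
    (Nat.cast_le.2 (Finset.le_sup (f := Prod.snd) i.2))
  have hDsum : 0 ≤ ∑ i, D i := Finset.sum_nonneg fun i _ => hD0 i
  refine ⟨s, C * ∑ i, D i, Nat.cast_nonneg _, mul_nonneg C.2 hDsum, fun φ => ?_⟩
  have hI : 0 ≤ ∫ ξ, bracketPow s ξ * ‖φ ξ‖ :=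
    integral_nonneg fun ξ => mul_nonneg (bracketPow_pos s ξ).le (norm_nonneg _)
  refine (hC (smulLeftCLM ℂ χ (𝓕 φ))).trans ?_
  change (C : ℝ) * (t.sup (schwartzSeminormFamily ℂ V ℂ)) _ ≤ _
  rw [mul_assoc]
  refine mul_le_mul_of_nonneg_left ?_ C.2
  refine Seminorm.finset_sup_apply_le (mul_nonneg hDsum hI) fun i hi => (hD ⟨i, hi⟩ φ).trans ?_
  gcongr
  exact Finset.single_le_sum (f := D) (fun i _ => hD0 i) (Finset.mem_univ _)

theorem exists_L2_representation (S : 𝓢(V, ℂ) →ₗ[ℂ] ℂ) {C : ℝ}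
    (hS : ∀ φ : 𝓢(V, ℂ), ‖S φ‖ ≤ C * ‖φ.toLp 2‖) :
    ∃ h : V → ℂ, MemLp h 2 ∧ ∀ φ : 𝓢(V, ℂ), S φ = ∫ ξ, h ξ * φ ξ := by
  let ι : 𝓢(V, ℂ) →L[ℂ] Lp ℂ 2 (volume : Measure V) := toLpCLM ℂ ℂ 2 volume
  have hdense : DenseRange ι.toLinearMap :=
    denseRange_toLpCLM (E := V) (F := ℂ) (p := 2) (μ := volume) (by simp)
  let F := S.extendOfNorm ι.toLinearMap
  have hF : ∀ φ : 𝓢(V, ℂ), F (φ.toLp 2) = S φ := fun φ =>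
    LinearMap.extendOfNorm_eq hdense ⟨C, hS⟩ φ
  let h := (InnerProductSpace.toDual ℂ (Lp ℂ 2 (volume : Measure V))).symm F
  refine ⟨fun ξ => star (h ξ), (Lp.memLp h).star, fun φ => ?_⟩
  rw [← hF, ← InnerProductSpace.toDual_symm_apply, L2.inner_def]
  refine integral_congr_ae ?_
  filter_upwards [φ.coeFn_toLp 2 volume] with ξ hξ
  rw [hξ, RCLike.inner_apply, mul_comm]
  rfl

theorem exists_integral_bracketPow_neg_mul_norm_le {s : ℝ} (hs : Module.finrank ℝ V < 4 * s) :
    ∃ A : ℝ, ∀ φ : 𝓢(V, ℂ), ∫ ξ, bracketPow (-s) ξ * ‖φ ξ‖ ≤ A * ‖φ.toLp 2‖ := by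
  refine ⟨(∫ x : V, bracketPow (-s) x ^ (2 : ℝ)) ^ (1 / (2 : ℝ)), fun φ => ?_⟩
  have hHolder := integral_mul_le_Lp_mul_Lq_of_nonneg (μ := (volume : Measure V))
    Real.HolderConjugate.two_two (f := bracketPow (-s)) (g := fun x => ‖φ x‖)
    (Eventually.of_forall fun x => (bracketPow_pos _ x).le)
    (Eventually.of_forall fun x => norm_nonneg _)
    (by simpa using memLp_two_bracketPow_neg volume hs) (by simpa using (φ.memLp 2).norm)
  rw [norm_toLp' (by simp) (by simp)]
  simpa using hHolder

theorem exists_integrable_representation (T : 𝓢(V, ℂ) →ₗ[ℂ] ℂ) {s C : ℝ} (hs : 0 ≤ s) (hC : 0 ≤ C)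
    (hT : ∀ φ, ‖T φ‖ ≤ C * ∫ ξ, bracketPow s ξ * ‖φ ξ‖) :
    ∃ (t : ℝ) (G : V → ℂ), 0 ≤ t ∧ Integrable G ∧ ∀ φ, T φ = ∫ ξ, G ξ * bracketMul t φ ξ := by
  let d : ℝ := Module.finrank ℝ V + 1
  have hd : Module.finrank ℝ V < 4 * d := by
    simp only [d]
    linarith [(Nat.cast_nonneg (Module.finrank ℝ V) : (0 : ℝ) ≤ _)]
  obtain ⟨A, hA⟩ := exists_integral_bracketPow_neg_mul_norm_le hd
  obtain ⟨h, hh, hrep⟩ := exists_L2_representation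
    (T ∘ₗ (bracketMul (-(s + d))).toLinearMap) (C := C * A) fun φ => by
      refine (hT _).trans ?_
      rw [mul_assoc]
      refine mul_le_mul_of_nonneg_left (le_trans (le_of_eq ?_) (hA φ)) hC
      refine integral_congr_ae (Eventually.of_forall fun ξ => ?_)
      change bracketPow s ξ * ‖bracketMul (-(s + d)) φ ξ‖ = _
      rw [norm_bracketMul_apply, ← mul_assoc, ← bracketPow_add]
      ring_nf
  refine ⟨s + d + d, fun ξ => h ξ * (bracketPow (-d) ξ : ℂ), by positivity,
    hh.integrable_mul (memLp_two_bracketPow_neg volume hd).ofReal, fun φ => ?_⟩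
  have hTφ : T φ = ∫ ξ, h ξ * bracketMul (s + d) φ ξ := by
    rw [← hrep, LinearMap.comp_apply]
    change _ = T (bracketMul _ (bracketMul _ φ))
    rw [bracketMul_bracketMul, neg_add_cancel, bracketMul_zero]
  rw [hTφ]
  congr 1 with ξ
  rw [mul_assoc, ← bracketMul_apply, bracketMul_bracketMul, neg_add_cancel_comm_assoc]

end WeightedIntegral

section FourierFunction

open Distribution

section Kernel

variable {X Y : Type*} [TopologicalSpace X] [TopologicalSpace Y] [MeasurableSpace Y]
  [OpensMeasurableSpace Y] {ν : Measure Y} {G : Y → ℂ} {k : X → Y → ℂ} {b : X → ℝ}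

theorem continuous_integral_mul_kernel [FirstCountableTopology X] (hG : Integrable G ν)
    (hk : Continuous (Function.uncurry k)) (hb : Continuous b) (hkb : ∀ x y, ‖k x y‖ ≤ b x) :
    Continuous fun x => ∫ y, G y * k x y ∂ν := by
  refine continuous_iff_continuousAt.2 fun x₀ =>
    continuousAt_of_dominated (bound := fun y => ‖G y‖ * (b x₀ + 1))
      (Eventually.of_forall fun x => hG.aestronglyMeasurable.mul
        (hk.uncurry_left x).aestronglyMeasurable) ?_ (hG.norm.mul_const _)
      (Eventually.of_forall fun y => (continuous_const.mul (hk.uncurry_right y)).continuousAt)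
  filter_upwards [hb.continuousAt.eventually_lt continuousAt_const (lt_add_one (b x₀))] with x hx
  refine Eventually.of_forall fun y => ?_
  rw [norm_mul]
  gcongr
  exact (hkb x y).trans hx.le

theorem integrable_mul_kernel_mul [SecondCountableTopology Y] [MeasurableSpace X]
    [OpensMeasurableSpace X] {μ : Measure X} (hG : Integrable G ν)
    (hk : Continuous (Function.uncurry k)) (hkb : ∀ x y, ‖k x y‖ ≤ b x) {φ : X → ℂ}
    (hφ : AEStronglyMeasurable φ μ) (hbφ : Integrable (fun x => b x * ‖φ x‖) μ) :
    Integrable (fun z : X × Y => G z.2 * k z.1 z.2 * φ z.1) (μ.prod ν) := by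
  refine (hbφ.mul_prod hG.norm).mono' ((hG.aestronglyMeasurable.comp_snd.mul
    hk.aestronglyMeasurable).mul hφ.comp_fst) (Eventually.of_forall fun z => ?_)
  calc ‖G z.2 * k z.1 z.2 * φ z.1‖ = ‖k z.1 z.2‖ * (‖φ z.1‖ * ‖G z.2‖) := by
        rw [norm_mul, norm_mul]
        ring
    _ ≤ b z.1 * (‖φ z.1‖ * ‖G z.2‖) := by
        gcongr
        exact hkb _ _
    _ = _ := (mul_assoc _ _ _).symm

end Kernel

variable {V : Type*} [NormedAddCommGroup V] [InnerProductSpace ℝ V] [FiniteDimensional ℝ V]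
  [MeasurableSpace V] [BorelSpace V]

theorem exists_continuous_convolution_representation {G : V → ℂ} (hG : Integrable G) {s : ℝ}
    (hs : 0 ≤ s) (θ : 𝓢(V, ℂ)) :
    ∃ g : V → ℂ, Continuous g ∧ ∀ φ : 𝓢(V, ℂ), Integrable (fun η => g η * φ η) ∧
      ∫ ξ, G ξ * bracketMul s (SchwartzMap.convolution (ContinuousLinearMap.mul ℂ ℂ) θ φ) ξ =
        ∫ η, g η * φ η := by
  obtain ⟨D, _, hD⟩ := exists_bracketPow_mul_norm_le s θ
  let k : V → V → ℂ := fun η ξ => bracketPow s ξ * θ (ξ - η)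
  have hk : Continuous (Function.uncurry k) :=
    (Complex.continuous_ofReal.comp ((continuous_bracketPow s).comp continuous_snd)).mul
      (θ.continuous.comp (continuous_snd.sub continuous_fst))
  have hkb : ∀ η ξ, ‖k η ξ‖ ≤ 2 ^ s * D * bracketPow s η := fun η ξ =>
    have := (bracketPow_pos s η).le
    calc ‖k η ξ‖ = bracketPow s ξ * ‖θ (ξ - η)‖ := by
          rw [norm_mul, Complex.norm_real, Real.norm_of_nonneg (bracketPow_pos s ξ).le]
      _ ≤ 2 ^ s * bracketPow s (ξ - η) * bracketPow s η * ‖θ (ξ - η)‖ := by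
          gcongr
          exact bracketPow_le_two_rpow_mul hs ξ η
      _ = 2 ^ s * (bracketPow s (ξ - η) * ‖θ (ξ - η)‖) * bracketPow s η := by ring
      _ ≤ 2 ^ s * D * bracketPow s η := by
          gcongr
          exact hD _
  have hint : ∀ φ : 𝓢(V, ℂ), Integrable (fun z : V × V => G z.2 * k z.1 z.2 * φ z.1)
      ((volume : Measure V).prod volume) := fun φ =>
    integrable_mul_kernel_mul hG hk hkb φ.continuous.aestronglyMeasurable (by
      simpa only [mul_assoc] using (integrable_bracketPow_mul_norm s φ).const_mul (2 ^ s * D))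
  refine ⟨fun η => ∫ ξ, G ξ * k η ξ, continuous_integral_mul_kernel hG hk
    (continuous_const.mul (continuous_bracketPow s)) hkb, fun φ => ⟨?_, ?_⟩⟩
  · simpa only [integral_mul_const] using (hint φ).integral_prod_left
  · simp only [← integral_mul_const]
    rw [integral_integral_swap (hint φ)]
    congr 1 with ξ
    rw [bracketMul_apply, SchwartzMap.convolution_apply, convolution_eq_swap, ← mul_assoc,
      ← integral_const_mul]
    congr 1 with η
    simp only [k, ContinuousLinearMap.mul_apply']
    ring

theorem exists_continuous_fourier {u : 𝓢'(V, ℂ)} {M : Set V} (hM : IsCompact M)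
    (hu : dsupport u ⊆ M) :
    ∃ g : V → ℂ, Continuous g ∧ ∀ φ : 𝓢(V, ℂ),
      Integrable (fun ξ => g ξ * φ ξ) ∧ (𝓕 u) φ = ∫ ξ, g ξ * φ ξ := by
  obtain ⟨χ, -, hχ, -, -⟩ := exists_schwartz_eq_one_nhdsSet hM.isClosed Metric.isOpen_thickening
    hM.isBounded.thickening (Metric.self_subset_thickening one_pos M)
  obtain ⟨s, C, hs, hC, hb⟩ := exists_norm_apply_smul_fourier_le u χ
  obtain ⟨t, G, ht, hG, hrep⟩ := exists_integrable_representation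
    ((u : 𝓢(V, ℂ) →ₗ[ℂ] ℂ) ∘ₗ (FourierTransform.fourierCLM ℂ 𝓢(V, ℂ)).toLinearMap) hs hC
    fun φ => apply_smulLeftCLM_eq hu hχ (𝓕 φ) ▸ hb φ
  obtain ⟨g, hgc, hg⟩ := exists_continuous_convolution_representation hG ht (𝓕⁻ χ)
  refine ⟨g, hgc, fun φ => ⟨(hg φ).1, ?_⟩⟩
  -- Since `u = χu`, the functional `φ ↦ u (𝓕 φ)` is unchanged by convolving `φ` with `𝓕⁻ χ`.
  rw [← (hg φ).2, ← hrep]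
  change u (𝓕 φ) = u (𝓕 (SchwartzMap.convolution _ (𝓕⁻ χ) φ))
  rw [SchwartzMap.fourier_convolution, FourierTransform.fourier_fourierInv_eq,
    ← apply_smulLeftCLM_eq hu hχ]
  congr 1
  ext x
  rw [SchwartzMap.smulLeftCLM_apply_apply χ.hasTemperateGrowth, SchwartzMap.pairing_apply_apply,
    ContinuousLinearMap.mul_apply', smul_eq_mul]

end FourierFunction

section Radial

theorem rpow_lintegral_le {X : Type*} [MeasurableSpace X] (ν : Measure X) {f : X → ℝ≥0∞}
    (hf : AEMeasurable f ν) {s : ℝ} (hs : 1 ≤ s) :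
    (∫⁻ x, f x ∂ν) ^ s ≤ ν univ ^ (s - 1) * ∫⁻ x, f x ^ s ∂ν := by
  have hs0 : 0 < s := one_pos.trans_le hs
  have h := eLpNorm'_le_eLpNorm'_mul_rpow_measure_univ one_pos hs hf.aestronglyMeasurable
  simp only [eLpNorm', enorm_eq_self, ENNReal.rpow_one, div_one, one_div] at h
  calc (∫⁻ x, f x ∂ν) ^ s
      ≤ ((∫⁻ x, f x ^ s ∂ν) ^ s⁻¹ * ν univ ^ (1 - s⁻¹)) ^ s := by gcongr
    _ = _ := by
        rw [ENNReal.mul_rpow_of_nonneg _ _ hs0.le, ← ENNReal.rpow_mul, ← ENNReal.rpow_mul,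
          inv_mul_cancel₀ hs0.ne', ENNReal.rpow_one, sub_mul, inv_mul_cancel₀ hs0.ne', one_mul,
          mul_comm]

theorem lintegral_eq_lintegral_Ioi_lintegral_sphere {V : Type*} [NormedAddCommGroup V]
    [NormedSpace ℝ V] [FiniteDimensional ℝ V] [Nontrivial V] [MeasurableSpace V] [BorelSpace V]
    (μ : Measure V) [μ.IsAddHaarMeasure] {f : V → ℝ≥0∞} (hf : Measurable f) :
    ∫⁻ x, f x ∂μ = ∫⁻ r in Ioi (0 : ℝ),
      (∫⁻ ω : Metric.sphere (0 : V) 1, f (r • (ω : V)) ∂μ.toSphere) *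
        ENNReal.ofReal (r ^ (Module.finrank ℝ V - 1)) := by
  let H : Metric.sphere (0 : V) 1 × Ioi (0 : ℝ) → ℝ≥0∞ := fun z => f ((z.2 : ℝ) • (z.1 : V))
  have hH : Measurable H := hf.comp (by fun_prop)
  calc ∫⁻ x, f x ∂μ = ∫⁻ x : ({0}ᶜ : Set V), f x ∂μ.comap Subtype.val := by
        rw [lintegral_subtype_comap (measurableSet_singleton _).compl f, restrict_compl_singleton]
    _ = ∫⁻ x : ({0}ᶜ : Set V), H (homeomorphUnitSphereProd V x) ∂μ.comap Subtype.val := by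
        congr 1 with x
        have hx : ‖(x : V)‖ ≠ 0 := norm_ne_zero_iff.2 x.2
        simp [H, smul_smul, hx]
    _ = ∫⁻ z, H z ∂(μ.toSphere.prod (.volumeIoiPow (Module.finrank ℝ V - 1))) :=
        μ.measurePreserving_homeomorphUnitSphereProd.lintegral_comp hH
    _ = ∫⁻ r : Ioi (0 : ℝ), (∫⁻ ω, H (ω, r) ∂μ.toSphere)
          ∂(.volumeIoiPow (Module.finrank ℝ V - 1)) := lintegral_prod_symm' _ hH
    _ = ∫⁻ r : Ioi (0 : ℝ), (∫⁻ ω, H (ω, r) ∂μ.toSphere) *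
          ENNReal.ofReal ((r : ℝ) ^ (Module.finrank ℝ V - 1)) ∂(.comap Subtype.val volume) := by
        rw [Measure.volumeIoiPow, lintegral_withDensity_eq_lintegral_mul _ (by fun_prop)
          hH.lintegral_prod_left']
        simp only [Pi.mul_apply, mul_comm]
    _ = _ := lintegral_subtype_comap measurableSet_Ioi (fun r : ℝ =>
        (∫⁻ ω : Metric.sphere (0 : V) 1, f (r • (ω : V)) ∂μ.toSphere) *
          ENNReal.ofReal (r ^ (Module.finrank ℝ V - 1)))

variable {n : ℕ} {g : Rn n → ℂ} {p : ℝ}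

theorem measurable_sphericalMean (hg : Continuous g) : Measurable (sphericalMean g) := by
  have hcont : Continuous fun z : ℝ × Metric.sphere (0 : Rn n) 1 => g (z.1 • (z.2 : Rn n)) := by
    fun_prop
  exact (hcont.measurable.enorm.pow_const 2).lintegral_prod_right'

variable [NeZero n]

theorem lintegral_ball_eq_lintegral_Ioo_lintegral_sphere {f : Rn n → ℝ≥0∞} (hf : Measurable f)
    (L : ℝ) :
    ∫⁻ x in Metric.ball (0 : Rn n) L, f x = ∫⁻ r in Ioo (0 : ℝ) L,
      (∫⁻ ω : Metric.sphere (0 : Rn n) 1, f (r • (ω : Rn n)) ∂(volume : Measure (Rn n)).toSphere) *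
        ENNReal.ofReal (r ^ ((n : ℝ) - 1)) := by
  have hpow : ∀ r : ℝ, r ^ (n - 1) = r ^ ((n : ℝ) - 1) := fun r => by
    rw [← Real.rpow_natCast, Nat.cast_pred (NeZero.pos n)]
  rw [← lintegral_indicator measurableSet_ball,
    lintegral_eq_lintegral_Ioi_lintegral_sphere volume (hf.indicator measurableSet_ball),
    finrank_euclideanSpace_fin, ← Ioi_inter_Iio, inter_comm,
    ← Measure.restrict_restrict measurableSet_Iio, ← lintegral_indicator measurableSet_Iio]
  refine setLIntegral_congr_fun measurableSet_Ioi fun r hr => ?_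
  have hball : ∀ ω : Metric.sphere (0 : Rn n) 1, r • (ω : Rn n) ∈ Metric.ball 0 L ↔ r ∈ Iio L :=
    fun ω => by
      rw [mem_ball_zero_iff, norm_smul, norm_eq_of_mem_sphere, mul_one,
        Real.norm_of_nonneg (le_of_lt hr), mem_Iio]
  by_cases hrL : r ∈ Iio L
  · simp [indicator_of_mem, hball, hrL, hpow]
  · simp [indicator_of_notMem, hball, hrL]

theorem setLIntegral_Ioo_ofReal_rpow_le {s L : ℝ} (hs : 0 ≤ s) (hL : 0 < L) :
    ∫⁻ r in Ioo (0 : ℝ) L, ENNReal.ofReal (r ^ s) ≤ ENNReal.ofReal (L ^ (s + 1)) :=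
  calc ∫⁻ r in Ioo (0 : ℝ) L, ENNReal.ofReal (r ^ s)
      ≤ ∫⁻ _ in Ioo (0 : ℝ) L, ENNReal.ofReal (L ^ s) :=
        setLIntegral_mono measurable_const fun r hr =>
          ENNReal.ofReal_le_ofReal (Real.rpow_le_rpow hr.1.le hr.2.le hs)
    _ = ENNReal.ofReal (L ^ (s + 1)) := by
        rw [setLIntegral_const, Real.volume_Ioo, sub_zero, ← ENNReal.ofReal_mul (by positivity),
          Real.rpow_add_one hL.ne']

theorem rpow_lintegral_ball_enorm_sq_le (hg : Continuous g) (hp : 2 ≤ p) {L : ℝ} (hL : 0 < L) :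
    (∫⁻ ξ in Metric.ball (0 : Rn n) L, ‖g ξ‖ₑ ^ 2) ^ (p / 2) ≤
      ENNReal.ofReal (L ^ (n : ℝ)) ^ (p / 2 - 1) * ∫⁻ r in Ioo (0 : ℝ) L,
        sphericalMean g r ^ (p / 2) * ENNReal.ofReal (r ^ ((n : ℝ) - 1)) := by
  have hn : (1 : ℝ) ≤ n := by exact_mod_cast NeZero.one_le
  let w : ℝ → ℝ≥0∞ := fun r => ENNReal.ofReal (r ^ ((n : ℝ) - 1))
  have hw : Measurable w := by fun_prop
  let ν := (volume.restrict (Ioo (0 : ℝ) L)).withDensity w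
  have hν : ∀ f : ℝ → ℝ≥0∞, Measurable f →
      ∫⁻ r, f r ∂ν = ∫⁻ r in Ioo (0 : ℝ) L, f r * w r := fun f hf => by
    rw [lintegral_withDensity_eq_lintegral_mul _ hw hf]
    simp only [Pi.mul_apply, mul_comm]
  have hν_univ : ν univ ≤ ENNReal.ofReal (L ^ (n : ℝ)) := by
    rw [withDensity_apply _ MeasurableSet.univ, Measure.restrict_univ]
    simpa using setLIntegral_Ioo_ofReal_rpow_le (sub_nonneg.2 hn) hL
  have hσ := measurable_sphericalMean hg
  rw [lintegral_ball_eq_lintegral_Ioo_lintegral_sphere (by fun_prop) L]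
  change (∫⁻ r in Ioo (0 : ℝ) L, sphericalMean g r * w r) ^ (p / 2) ≤ _
  rw [← hν _ hσ, ← hν _ (hσ.pow_const _)]
  refine (rpow_lintegral_le ν hσ.aemeasurable (by linarith)).trans ?_
  gcongr
  linarith

theorem lintegral_sphericalMean_rpow_le (hg : Continuous g) (hp : 2 ≤ p) (L : ℝ) :
    ∫⁻ r in Ioo (0 : ℝ) L, sphericalMean g r ^ (p / 2) * ENNReal.ofReal (r ^ ((n : ℝ) - 1)) ≤
      (volume : Measure (Rn n)).toSphere univ ^ (p / 2 - 1) *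
        ∫⁻ ξ in Metric.ball (0 : Rn n) L, ‖g ξ‖ₑ ^ p := by
  have hpow : ∀ x : ℝ≥0∞, (x ^ 2) ^ (p / 2) = x ^ p := fun x => by
    rw [← ENNReal.rpow_ofNat, ← ENNReal.rpow_mul, mul_div_cancel₀ p two_ne_zero]
  rw [lintegral_ball_eq_lintegral_Ioo_lintegral_sphere (by fun_prop) L, ← lintegral_const_mul'
    _ _ (ENNReal.rpow_ne_top_of_nonneg (by linarith) (measure_ne_top _ _))]
  refine lintegral_mono fun r => ?_
  rw [← mul_assoc]
  gcongr
  have hJensen := rpow_lintegral_le (volume : Measure (Rn n)).toSphere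
    (f := fun ω : Metric.sphere (0 : Rn n) 1 => ‖g (r • (ω : Rn n))‖ₑ ^ 2)
    ((hg.comp (by fun_prop)).measurable.enorm.pow_const 2).aemeasurable
    (s := p / 2) (by linarith)
  simp only [hpow] at hJensen
  exact hJensen

theorem radialLimsup_le_mul_ballLimsup (hg : Continuous g) (hp : 2 ≤ p) (k : ℝ) :
    radialLimsup g p k ≤ (volume : Measure (Rn n)).toSphere univ ^ (p / 2 - 1) *
      ballLimsup g p k := by
  unfold radialLimsup ballLimsup
  rw [← ENNReal.limsup_const_mul_of_ne_top
    (ENNReal.rpow_ne_top_of_nonneg (by linarith) (measure_ne_top _ _))]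
  refine limsup_le_limsup (Eventually.of_forall fun L => ?_)
  beta_reduce
  rw [mul_left_comm]
  gcongr
  exact lintegral_sphericalMean_rpow_le hg hp L

end Radial

section Dyadic

variable {V : Type*} [NormedAddCommGroup V]

theorem exists_norm_lt_two_pow_and_le {w : V → ℝ≥0∞} {d : ℕ} {D : ℝ≥0∞}
    (hw : ∀ x, ENNReal.ofReal (1 + ‖x‖) ^ d * w x ≤ D) (x : V) :
    ∃ j : ℕ, ‖x‖ < 2 ^ j ∧ w x ≤ D * (2 * 2⁻¹ ^ j) ^ d := by
  obtain ⟨i, hi, hi'⟩ := exists_nat_pow_near (x := 1 + ‖x‖) (by simp) one_lt_two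
  refine ⟨i + 1, by linarith, ?_⟩
  have hle : 2 ^ i ≤ ENNReal.ofReal (1 + ‖x‖) := by
    simpa using ENNReal.ofReal_le_ofReal hi
  have hne : ENNReal.ofReal (1 + ‖x‖) ^ d ≠ 0 :=
    pow_ne_zero _ (ENNReal.ofReal_pos.2 (by positivity)).ne'
  calc w x ≤ D / ENNReal.ofReal (1 + ‖x‖) ^ d :=
        (ENNReal.le_div_iff_mul_le (.inl hne) (by simp)).2 (by simpa only [mul_comm] using hw x)
    _ ≤ D / (2 ^ i) ^ d := by gcongr
    _ = D * (2 * 2⁻¹ ^ (i + 1)) ^ d := by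
        rw [pow_succ', ← mul_assoc, ENNReal.mul_inv_cancel (by simp) (by simp), one_mul,
          div_eq_mul_inv, ENNReal.inv_pow, ENNReal.inv_pow]

variable [NormedSpace ℝ V] [MeasurableSpace V] [OpensMeasurableSpace V] {μ : Measure V}
  {f w : V → ℝ≥0∞} {d : ℕ} {D K : ℝ≥0∞} {m L₀ ε : ℝ}

theorem lintegral_mul_comp_smul_le_tsum (hf : Measurable f)
    (hw : ∀ x, ENNReal.ofReal (1 + ‖x‖) ^ d * w x ≤ D) (hε : 0 < ε) :
    ∫⁻ x, f x * w (ε • x) ∂μ ≤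
      ∑' j : ℕ, D * (2 * 2⁻¹ ^ j) ^ d * ∫⁻ x in Metric.ball 0 (2 ^ j * ε⁻¹), f x ∂μ := by
  let B : ℕ → Set V := fun j => Metric.ball 0 (2 ^ j * ε⁻¹)
  have hpt : ∀ x, f x * w (ε • x) ≤ ∑' j, D * (2 * 2⁻¹ ^ j) ^ d * (B j).indicator f x := by
    intro x
    obtain ⟨j, hj, hwj⟩ := exists_norm_lt_two_pow_and_le hw (ε • x)
    have hx : x ∈ B j := by
      rwa [mem_ball_zero_iff, ← div_eq_mul_inv, lt_div_iff₀' hε, ← Real.norm_of_nonneg hε.le,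
        ← norm_smul]
    refine le_trans ?_ (ENNReal.le_tsum j)
    rw [indicator_of_mem hx, mul_comm]
    gcongr
  have hB : ∀ j, Measurable ((B j).indicator f) := fun j => hf.indicator measurableSet_ball
  refine (lintegral_mono hpt).trans_eq ?_
  rw [lintegral_tsum fun j => ((hB j).const_mul _).aemeasurable]
  congr 1 with j
  rw [lintegral_const_mul _ (hB j), lintegral_indicator measurableSet_ball]

theorem lintegral_mul_comp_smul_le (hf : Measurable f)
    (hw : ∀ x, ENNReal.ofReal (1 + ‖x‖) ^ (d + 1) * w x ≤ D) (hm : m ≤ d)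
    (hK : ∀ L, L₀ ≤ L → ∫⁻ x in Metric.ball 0 L, f x ∂μ ≤ K * ENNReal.ofReal (L ^ m))
    (hε : 0 < ε) (hε₀ : L₀ ≤ ε⁻¹) :
    ∫⁻ x, f x * w (ε • x) ∂μ ≤ 2 ^ (d + 2) * D * K * ENNReal.ofReal (ε ^ (-m)) := by
  have hball : ∀ j : ℕ, ∫⁻ x in Metric.ball 0 (2 ^ j * ε⁻¹), f x ∂μ ≤
      K * ((2 ^ j) ^ d * ENNReal.ofReal (ε ^ (-m))) := fun j => by
    have h2j : (1 : ℝ) ≤ 2 ^ j := one_le_pow₀ one_le_two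
    refine (hK _ (hε₀.trans (le_mul_of_one_le_left (by positivity) h2j))).trans ?_
    rw [Real.mul_rpow (by positivity) (by positivity), Real.inv_rpow hε.le, ← Real.rpow_neg hε.le,
      ENNReal.ofReal_mul (by positivity)]
    gcongr
    calc ENNReal.ofReal ((2 ^ j) ^ m) ≤ ENNReal.ofReal ((2 ^ j) ^ d) := by
          refine ENNReal.ofReal_le_ofReal ?_
          rw [← Real.rpow_natCast _ d]
          exact Real.rpow_le_rpow_of_exponent_le h2j hm
      _ = _ := by simp [ENNReal.ofReal_pow]
  have hcancel : ∀ j : ℕ, (2 * 2⁻¹ ^ j : ℝ≥0∞) ^ (d + 1) * (2 ^ j) ^ d = 2 ^ (d + 1) * 2⁻¹ ^ j :=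
    fun j => by
      rw [mul_pow, mul_assoc, pow_succ (2⁻¹ ^ j), mul_right_comm, ← mul_pow, ← mul_pow,
        ENNReal.inv_mul_cancel two_ne_zero (by simp), one_pow, one_pow, one_mul]
  calc ∫⁻ x, f x * w (ε • x) ∂μ
      ≤ ∑' j : ℕ, D * (2 * 2⁻¹ ^ j) ^ (d + 1) *
          (K * ((2 ^ j) ^ d * ENNReal.ofReal (ε ^ (-m)))) :=
        (lintegral_mul_comp_smul_le_tsum hf hw hε).trans
          (ENNReal.tsum_le_tsum fun j => by gcongr; exact hball j)
    _ = ∑' j : ℕ, 2⁻¹ ^ j * (2 ^ (d + 1) * D * K * ENNReal.ofReal (ε ^ (-m))) := by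
        congr 1 with j
        calc _ = (2 * 2⁻¹ ^ j) ^ (d + 1) * (2 ^ j) ^ d * (D * K * ENNReal.ofReal (ε ^ (-m))) := by
              ring
          _ = _ := by
              rw [hcancel]
              ring
    _ = _ := by
        rw [ENNReal.tsum_mul_right, ENNReal.tsum_geometric, ENNReal.one_sub_inv_two, inv_inv]
        ring

end Dyadic

section Mollifier

open Distribution

variable {V : Type*} [NormedAddCommGroup V] [InnerProductSpace ℝ V]

/-- The `L¹`-normalized dilate `x ↦ |ε|⁻ᵈ χ (ε⁻¹ x)` of a Schwartz function, where `d` is the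
dimension; it serves as the mollifier at scale `ε`. -/
noncomputable def dilate {ε : ℝ} (hε : ε ≠ 0) (χ : 𝓢(V, ℂ)) : 𝓢(V, ℂ) :=
  (|ε| ^ Module.finrank ℝ V)⁻¹ • SchwartzMap.compCLMOfContinuousLinearEquiv ℝ
    (ContinuousLinearEquiv.smulLeft (Units.mk0 ε hε)⁻¹ : V ≃L[ℝ] V) χ

theorem dilate_apply {ε : ℝ} (hε : ε ≠ 0) (χ : 𝓢(V, ℂ)) (x : V) :
    dilate hε χ x = (|ε| ^ Module.finrank ℝ V)⁻¹ • χ (ε⁻¹ • x) :=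
  rfl

variable [FiniteDimensional ℝ V] [MeasurableSpace V] [BorelSpace V]

/-- The pairing with `ψ` of the mollification at scale `ε` of a tempered distribution with Fourier
transform `g`, written on the Fourier side so that it makes sense for every `ε`. -/
noncomputable def mollifiedPairing (g : V → ℂ) (χ : 𝓢(V, ℂ)) (ε : ℝ) (ψ : 𝓢(V, ℂ)) : ℂ :=
  ∫ ξ, g ξ * (𝓕⁻ χ (ε • ξ) * 𝓕⁻ ψ ξ)

theorem fourierInv_dilate {ε : ℝ} (hε : ε ≠ 0) (χ : 𝓢(V, ℂ)) (ξ : V) :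
    𝓕⁻ (dilate hε χ) ξ = 𝓕⁻ χ (ε • ξ) := by
  have hphase : ∀ x, Real.fourierChar (inner ℝ x ξ) • dilate hε χ x =
      (|ε| ^ Module.finrank ℝ V)⁻¹ •
        (Real.fourierChar (inner ℝ (ε⁻¹ • x) (ε • ξ)) • χ (ε⁻¹ • x)) := fun x => by
    rw [dilate_apply, real_inner_smul_left, real_inner_smul_right, inv_mul_cancel_left₀ hε,
      smul_comm]
  rw [SchwartzMap.fourierInv_coe, SchwartzMap.fourierInv_coe, Real.fourierInv_eq,
    Real.fourierInv_eq]
  simp_rw [hphase]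
  rw [integral_smul, Measure.integral_comp_smul volume
    (fun x => Real.fourierChar (inner ℝ x (ε • ξ)) • χ x), smul_smul, inv_pow, inv_inv, abs_pow,
    inv_mul_cancel₀ (by positivity), one_smul]

theorem fourierInv_convolution (χ ψ : 𝓢(V, ℂ)) (ξ : V) :
    𝓕⁻ (SchwartzMap.convolution (ContinuousLinearMap.mul ℂ ℂ) χ ψ) ξ = 𝓕⁻ χ ξ * 𝓕⁻ ψ ξ := by
  have hneg : ∀ φ : 𝓢(V, ℂ), 𝓕⁻ φ ξ = 𝓕 φ (-ξ) := fun φ => by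
    rw [SchwartzMap.fourierInv_coe, SchwartzMap.fourier_coe, Real.fourierInv_eq_fourier_neg]
  rw [hneg, hneg, hneg, SchwartzMap.fourier_convolution, SchwartzMap.pairing_apply_apply,
    ContinuousLinearMap.mul_apply']

variable {u : 𝓢'(V, ℂ)} {g : V → ℂ} {χ : 𝓢(V, ℂ)}

theorem apply_eq_integral_mul_fourierInv (hg : ∀ φ : 𝓢(V, ℂ), 𝓕 u φ = ∫ ξ, g ξ * φ ξ)
    (ψ : 𝓢(V, ℂ)) : u ψ = ∫ ξ, g ξ * 𝓕⁻ ψ ξ := by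
  rw [← hg, TemperedDistribution.fourier_apply, FourierTransform.fourier_fourierInv_eq]

theorem mollifiedPairing_eq_apply_convolution (hg : ∀ φ : 𝓢(V, ℂ), 𝓕 u φ = ∫ ξ, g ξ * φ ξ)
    {ε : ℝ} (hε : ε ≠ 0) (ψ : 𝓢(V, ℂ)) :
    mollifiedPairing g χ ε ψ =
      u (SchwartzMap.convolution (ContinuousLinearMap.mul ℂ ℂ) (dilate hε χ) ψ) := by
  simp only [apply_eq_integral_mul_fourierInv hg, fourierInv_convolution, fourierInv_dilate,
    mollifiedPairing]

theorem tendsto_mollifiedPairing (hgc : Continuous g)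
    (hg : ∀ φ : 𝓢(V, ℂ), Integrable (fun ξ => g ξ * φ ξ) ∧ 𝓕 u φ = ∫ ξ, g ξ * φ ξ)
    (hχ : 𝓕⁻ χ 0 = 1) (ψ : 𝓢(V, ℂ)) :
    Tendsto (fun ε => mollifiedPairing g χ ε ψ) (𝓝 0) (𝓝 (u ψ)) := by
  rw [apply_eq_integral_mul_fourierInv (fun φ => (hg φ).2)]
  refine tendsto_integral_filter_of_dominated_convergence
    (fun ξ => SchwartzMap.seminorm ℝ 0 0 (𝓕⁻ χ) * ‖g ξ * 𝓕⁻ ψ ξ‖)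
    (Eventually.of_forall fun ε => Continuous.aestronglyMeasurable (by fun_prop))
    (Eventually.of_forall fun ε => Eventually.of_forall fun ξ => ?_)
    ((hg _).1.norm.const_mul _) (Eventually.of_forall fun ξ => ?_)
  · rw [mul_left_comm, norm_mul]
    gcongr
    exact SchwartzMap.norm_le_seminorm ℝ _ _
  · have hcont : Continuous fun ε : ℝ => g ξ * (𝓕⁻ χ (ε • ξ) * 𝓕⁻ ψ ξ) := by fun_prop
    simpa only [zero_smul, hχ, one_mul] using hcont.tendsto 0

theorem lintegral_enorm_sq_fourierInv (ψ : 𝓢(V, ℂ)) :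
    ∫⁻ ξ, ‖𝓕⁻ ψ ξ‖ₑ ^ 2 = ∫⁻ x, ‖ψ x‖ₑ ^ 2 := by
  have hofReal : ∀ φ : 𝓢(V, ℂ), ∫⁻ x, ‖φ x‖ₑ ^ 2 = ENNReal.ofReal (∫ x, ‖φ x‖ ^ 2) := fun φ => by
    rw [ofReal_integral_eq_lintegral_ofReal
      ((memLp_two_iff_integrable_sq_norm φ.continuous.aestronglyMeasurable).1 (φ.memLp 2 volume))
      (Eventually.of_forall fun x => by positivity)]
    simp only [ENNReal.ofReal_pow (norm_nonneg _), ofReal_norm]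
  rw [hofReal, hofReal, ← SchwartzMap.integral_norm_sq_fourier,
    FourierTransform.fourier_fourierInv_eq]

theorem lintegral_mul_sq_le {X : Type*} [MeasurableSpace X] (ν : Measure X) {f h : X → ℝ≥0∞}
    (hf : AEMeasurable f ν) (hh : AEMeasurable h ν) :
    (∫⁻ x, f x * h x ∂ν) ^ 2 ≤ (∫⁻ x, f x ^ 2 ∂ν) * ∫⁻ x, h x ^ 2 ∂ν := by
  have hHolder := ENNReal.lintegral_mul_le_Lp_mul_Lq ν Real.HolderConjugate.two_two hf hh
  simp only [Pi.mul_apply, ENNReal.rpow_ofNat] at hHolder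
  have hroot : ∀ a : ℝ≥0∞, (a ^ (1 / 2 : ℝ)) ^ 2 = a := fun a => by
    rw [← ENNReal.rpow_ofNat, ← ENNReal.rpow_mul, one_div_mul_cancel two_ne_zero,
      ENNReal.rpow_one]
  simpa only [mul_pow, hroot] using pow_le_pow_left₀ zero_le hHolder 2

theorem enorm_mollifiedPairing_sq_le (hg : Continuous g) (ε : ℝ) (ψ : 𝓢(V, ℂ)) :
    ‖mollifiedPairing g χ ε ψ‖ₑ ^ 2 ≤
      (∫⁻ ξ, ‖g ξ‖ₑ ^ 2 * ‖𝓕⁻ χ (ε • ξ)‖ₑ ^ 2) * ∫⁻ x, ‖ψ x‖ₑ ^ 2 :=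
  calc ‖mollifiedPairing g χ ε ψ‖ₑ ^ 2
      ≤ (∫⁻ ξ, ‖g ξ * 𝓕⁻ χ (ε • ξ)‖ₑ * ‖𝓕⁻ ψ ξ‖ₑ) ^ 2 := by
        simp only [← enorm_mul, mul_assoc]
        exact pow_le_pow_left₀ zero_le (enorm_integral_le_lintegral_enorm _) 2
    _ ≤ (∫⁻ ξ, ‖g ξ * 𝓕⁻ χ (ε • ξ)‖ₑ ^ 2) * ∫⁻ ξ, ‖𝓕⁻ ψ ξ‖ₑ ^ 2 :=
        lintegral_mul_sq_le _ (Continuous.aemeasurable (by fun_prop))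
          (Continuous.aemeasurable (by fun_prop))
    _ = _ := by simp only [enorm_mul, mul_pow, lintegral_enorm_sq_fourierInv]

theorem mollifiedPairing_congr {M : Set V} (hu : dsupport u ⊆ M)
    (hg : ∀ φ : 𝓢(V, ℂ), 𝓕 u φ = ∫ ξ, g ξ * φ ξ) (hχ : ∀ x, 1 / 2 ≤ ‖x‖ → χ x = 0) {ε : ℝ}
    (hε : 0 < ε) {ψ₁ ψ₂ : 𝓢(V, ℂ)} (hψ : EqOn ψ₁ ψ₂ (Metric.thickening (3 * ε / 4) M)) :
    mollifiedPairing g χ ε ψ₁ = mollifiedPairing g χ ε ψ₂ := by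
  rw [mollifiedPairing_eq_apply_convolution hg hε.ne',
    mollifiedPairing_eq_apply_convolution hg hε.ne']
  refine apply_eq_of_eventuallyEq_nhdsSet hu ?_
  filter_upwards [Metric.isOpen_thickening.mem_nhdsSet.2
    (Metric.self_subset_thickening (by positivity : 0 < ε / 4) M)] with x hx
  simp only [SchwartzMap.convolution_apply, convolution_def]
  congr 1 with t
  by_cases ht : ‖t‖ < ε / 2
  · have hxt : x - t ∈ Metric.thickening (ε / 2 + ε / 4) M :=
      Metric.thickening_thickening_subset _ _ _
        (Metric.mem_thickening_iff.2 ⟨x, hx, by simpa [dist_eq_norm] using ht⟩)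
    have hscale : ε / 2 + ε / 4 = 3 * ε / 4 := by ring
    rw [hψ (hscale ▸ hxt)]
  · have ht' : 1 / 2 ≤ ‖ε⁻¹ • t‖ := by
      rw [norm_smul, norm_inv, Real.norm_of_nonneg hε.le, inv_mul_eq_div, le_div_iff₀ hε]
      linarith
    rw [dilate_apply, hχ _ ht', smul_zero, map_zero, zero_apply, zero_apply]

theorem enorm_mollifiedPairing_sq_le_thickening {M : Set V} (hM : Bornology.IsBounded M)
    (hu : dsupport u ⊆ M) (hgc : Continuous g) (hg : ∀ φ : 𝓢(V, ℂ), 𝓕 u φ = ∫ ξ, g ξ * φ ξ)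
    (hχ : ∀ x, 1 / 2 ≤ ‖x‖ → χ x = 0) {ε : ℝ} (hε : 0 < ε) (ψ : 𝓢(V, ℂ)) :
    ‖mollifiedPairing g χ ε ψ‖ₑ ^ 2 ≤ (∫⁻ ξ, ‖g ξ‖ₑ ^ 2 * ‖𝓕⁻ χ (ε • ξ)‖ₑ ^ 2) *
      ∫⁻ x in Metric.thickening ε M, ‖ψ x‖ₑ ^ 2 := by
  obtain ⟨κ, -, hκ_one, hκ_zero, hκ_le⟩ := exists_schwartz_eq_one_nhdsSet
    Metric.isClosed_cthickening Metric.isOpen_thickening hM.thickening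
    (Metric.cthickening_subset_thickening' hε (by linarith : 3 * ε / 4 < ε) M)
  let κψ : 𝓢(V, ℂ) := SchwartzMap.smulLeftCLM ℂ κ ψ
  have hκψ : ∀ x, κψ x = κ x * ψ x := fun x => by
    rw [SchwartzMap.smulLeftCLM_apply_apply κ.hasTemperateGrowth, smul_eq_mul]
  have hcongr : mollifiedPairing g χ ε ψ = mollifiedPairing g χ ε κψ := by
    refine mollifiedPairing_congr hu hg hχ hε fun x hx => ?_
    rw [hκψ, hκ_one.self_of_nhdsSet x (Metric.thickening_subset_cthickening _ _ hx), one_mul]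
  rw [hcongr]
  refine (enorm_mollifiedPairing_sq_le hgc ε κψ).trans (mul_le_mul_right ?_ _)
  rw [← lintegral_indicator Metric.isOpen_thickening.measurableSet]
  refine lintegral_mono fun x => ?_
  rw [hκψ]
  by_cases hx : x ∈ Metric.thickening ε M
  · rw [indicator_of_mem hx, enorm_mul]
    gcongr
    exact mul_le_of_le_one_left zero_le
      (by simpa only [ofReal_norm] using ENNReal.ofReal_le_one.2 (hκ_le x))
  · simp [hκ_zero x hx]

variable (V) in
theorem exists_schwartz_fourierInv_zero_eq_one :
    ∃ χ : 𝓢(V, ℂ), (∀ x, 1 / 2 ≤ ‖x‖ → χ x = 0) ∧ 𝓕⁻ χ 0 = 1 := by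
  let b : ContDiffBump (0 : V) := ⟨1 / 4, 1 / 2, by norm_num, by norm_num⟩
  have hsupp : HasCompactSupport fun x => (b.normed volume x : ℂ) :=
    b.hasCompactSupport_normed.comp_left Complex.ofReal_zero
  refine ⟨hsupp.toSchwartzMap (Complex.ofRealCLM.contDiff.comp b.contDiff_normed),
    fun x hx => ?_, ?_⟩
  · have hb : b.normed volume x = 0 := by
      rw [← Function.notMem_support, b.support_normed_eq, mem_ball_zero_iff, not_lt]
      exact hx
    exact congrArg ((↑) : ℝ → ℂ) hb
  · rw [SchwartzMap.fourierInv_coe, Real.fourierInv_eq]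
    simp only [inner_zero_right, AddChar.map_zero_eq_one, one_smul]
    exact integral_ofReal.trans (congrArg ((↑) : ℝ → ℂ) (b.integral_normed (μ := volume)))

end Mollifier

section DualNorm

open Distribution

theorem setLIntegral_enorm_sq_le {X E : Type*} [MeasurableSpace X] [NormedAddCommGroup E]
    {ν : Measure X} {ψ : X → E} (hψ : AEStronglyMeasurable ψ ν) {q : ℝ≥0∞} (hq : 1 ≤ q)
    (hnorm : eLpNorm ψ (2 * q) ν ≤ 1) (S : Set X) :
    ∫⁻ x in S, ‖ψ x‖ₑ ^ 2 ∂ν ≤ ν S ^ (1 - q⁻¹.toReal) := by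
  have hexp : 2 * (1 / (2 : ℝ≥0∞).toReal - 1 / (2 * q).toReal) = 1 - q⁻¹.toReal := by
    rw [ENNReal.toReal_mul, ENNReal.toReal_ofNat, ENNReal.toReal_inv]
    field_simp
  have hL2 : ∫⁻ x in S, ‖ψ x‖ₑ ^ 2 ∂ν = eLpNorm ψ 2 (ν.restrict S) ^ (2 : ℝ) := by
    simpa using (eLpNorm_nnreal_pow_eq_lintegral (p := 2) two_ne_zero).symm
  calc ∫⁻ x in S, ‖ψ x‖ₑ ^ 2 ∂ν
      = eLpNorm ψ 2 (ν.restrict S) ^ (2 : ℝ) := hL2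
    _ ≤ (1 * ν S ^ (1 / (2 : ℝ≥0∞).toReal - 1 / (2 * q).toReal)) ^ (2 : ℝ) := by
        gcongr
        refine (eLpNorm_le_eLpNorm_mul_rpow_measure_univ (le_mul_of_one_le_right' hq)
          hψ.restrict).trans ?_
        rw [Measure.restrict_apply_univ]
        gcongr
        exact (eLpNorm_mono_measure _ Measure.restrict_le_self).trans hnorm
    _ = ν S ^ (1 - q⁻¹.toReal) := by rw [one_mul, ← ENNReal.rpow_mul, mul_comm, hexp]

theorem le_mul_ofReal_rpow_of_ofReal_rpow_neg_mul_le {a b : ℝ≥0∞} {x k : ℝ} (hx : 0 < x)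
    (h : ENNReal.ofReal (x ^ (-k)) * a ≤ b) : a ≤ b * ENNReal.ofReal (x ^ k) := by
  rwa [Real.rpow_neg hx.le, ENNReal.ofReal_inv_of_pos (by positivity), mul_comm, ← div_eq_mul_inv,
    ENNReal.div_le_iff (by positivity) ENNReal.ofReal_ne_top] at h

variable {n : ℕ} {α p : ℝ} {q : ℝ≥0∞}

theorem eventually_volume_thickening_le {M : Set (Rn n)} {B : ℝ≥0∞} (hB₀ : B ≠ 0) (hB : B ≠ ∞)
    (hM : upperMinkowskiContent α M ≤ B) :
    ∀ᶠ ε in 𝓝[>] (0 : ℝ), volume (Metric.thickening ε M) ≤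
      2 ^ ((n : ℝ) - α + 1) * B * ENNReal.ofReal (ε ^ ((n : ℝ) - α)) := by
  have hlt : upperMinkowskiContent α M < 2 * B := by
    rw [two_mul]
    exact hM.trans_lt (ENNReal.lt_add_right hB hB₀)
  filter_upwards [eventually_lt_of_limsup_lt hlt, self_mem_nhdsWithin] with ε hlt hε
  have hε : 0 < ε := hε
  rw [← neg_sub] at hlt
  calc volume (Metric.thickening ε M)
      ≤ 2 * B * ENNReal.ofReal ((2 * ε) ^ ((n : ℝ) - α)) :=
        le_mul_ofReal_rpow_of_ofReal_rpow_neg_mul_le (by positivity) hlt.le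
    _ = 2 ^ ((n : ℝ) - α + 1) * B * ENNReal.ofReal (ε ^ ((n : ℝ) - α)) := by
        rw [Real.mul_rpow two_pos.le hε.le, ENNReal.ofReal_mul (by positivity),
          ← ENNReal.ofReal_rpow_of_pos two_pos, ENNReal.ofReal_ofNat,
          ENNReal.rpow_add _ _ two_ne_zero ENNReal.ofNat_ne_top, ENNReal.rpow_one]
        ring

theorem eventually_lintegral_ball_enorm_sq_le [NeZero n] {g : Rn n → ℂ} (hg : Continuous g)
    {k m : ℝ} (hp : 2 ≤ p) (hm : m * (p / 2) = n * (p / 2 - 1) + k) {K : ℝ≥0∞}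
    (hK : radialLimsup g p k < K) :
    ∀ᶠ L in atTop, ∫⁻ ξ in Metric.ball (0 : Rn n) L, ‖g ξ‖ₑ ^ 2 ≤
      K ^ (2 / p) * ENNReal.ofReal (L ^ m) := by
  have hp₀ : 0 < p / 2 := by linarith
  filter_upwards [eventually_lt_of_limsup_lt hK, eventually_gt_atTop 0] with L hlt hL
  rw [← ENNReal.rpow_le_rpow_iff hp₀]
  calc (∫⁻ ξ in Metric.ball (0 : Rn n) L, ‖g ξ‖ₑ ^ 2) ^ (p / 2)
      ≤ ENNReal.ofReal (L ^ (n : ℝ)) ^ (p / 2 - 1) * (K * ENNReal.ofReal (L ^ k)) := by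
        refine (rpow_lintegral_ball_enorm_sq_le hg hp hL).trans ?_
        gcongr
        exact le_mul_ofReal_rpow_of_ofReal_rpow_neg_mul_le hL hlt.le
    _ = K * ENNReal.ofReal (L ^ (n * (p / 2 - 1) + k)) := by
        rw [Real.rpow_add hL, Real.rpow_mul hL.le, ENNReal.ofReal_mul (by positivity),
          ENNReal.ofReal_rpow_of_pos (by positivity), mul_left_comm]
    _ = (K ^ (2 / p) * ENNReal.ofReal (L ^ m)) ^ (p / 2) := by
        rw [← hm, Real.rpow_mul hL.le, ENNReal.mul_rpow_of_nonneg _ _ hp₀.le, ← ENNReal.rpow_mul,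
          div_mul_div_cancel₀ (by linarith), div_self two_ne_zero, ENNReal.rpow_one,
          ENNReal.ofReal_rpow_of_pos (by positivity)]

theorem exists_one_add_norm_pow_mul_enorm_sq_le {V : Type*} [NormedAddCommGroup V]
    [NormedSpace ℝ V] (ρ : 𝓢(V, ℂ)) (d : ℕ) :
    ∃ D : ℝ≥0, 0 < D ∧ ∀ x, ENNReal.ofReal (1 + ‖x‖) ^ d * ‖ρ x‖ₑ ^ 2 ≤ D := by
  obtain ⟨D, hD⟩ : ∃ D : ℝ≥0, ∀ x, ENNReal.ofReal (1 + ‖x‖) ^ d * ‖ρ x‖ₑ ≤ D := by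
    refine ⟨(2 ^ d * ((Finset.Iic (d, 0)).sup fun m =>
      SchwartzMap.seminorm ℝ m.1 m.2) ρ).toNNReal, fun x => ?_⟩
    have h := SchwartzMap.one_add_le_sup_seminorm_apply (𝕜 := ℝ) (m := (d, 0)) le_rfl le_rfl ρ x
    rw [norm_iteratedFDeriv_zero] at h
    rw [← ofReal_norm, ← ENNReal.ofReal_pow (by positivity), ← ENNReal.ofReal_mul (by positivity)]
    exact ENNReal.ofReal_le_ofReal h
  refine ⟨D ^ 2 + 1, by positivity, fun x => ?_⟩
  have hone : 1 ≤ ENNReal.ofReal (1 + ‖x‖) ^ d := one_le_pow₀ (by simp)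
  calc ENNReal.ofReal (1 + ‖x‖) ^ d * ‖ρ x‖ₑ ^ 2
      ≤ (ENNReal.ofReal (1 + ‖x‖) ^ d * ‖ρ x‖ₑ) ^ 2 := by
        rw [mul_pow]
        exact mul_le_mul' (le_self_pow₀ hone two_ne_zero) le_rfl
    _ ≤ (D : ℝ≥0∞) ^ 2 := by
        gcongr
        exact hD x
    _ ≤ (D ^ 2 + 1 : ℝ≥0) := by
        push_cast
        exact le_self_add

theorem eventually_enorm_mollifiedPairing_sq_le [NeZero n] {χ : 𝓢(Rn n, ℂ)}
    (hχ : ∀ x, 1 / 2 ≤ ‖x‖ → χ x = 0) {d : ℕ} {D : ℝ≥0∞}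
    (hD : ∀ x, ENNReal.ofReal (1 + ‖x‖) ^ (d + 1) * ‖𝓕⁻ χ x‖ₑ ^ 2 ≤ D)
    (hd : (n - α) * (1 - q⁻¹.toReal) ≤ d) (hq : 1 ≤ q) (hp : 2 ≤ p) {k : ℝ}
    (hk : (n - α) * (1 - q⁻¹.toReal) * (p / 2) = n * (p / 2 - 1) + k)
    {M : Set (Rn n)} (hM : Bornology.IsBounded M) {u : 𝓢'(Rn n, ℂ)} (hu : dsupport u ⊆ M)
    {g : Rn n → ℂ} (hg : IsFourierFunction u g) {B : ℝ≥0∞} (hB₀ : B ≠ 0) (hB : B ≠ ∞)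
    (hMB : upperMinkowskiContent α M ≤ B) {K : ℝ≥0∞} (hK : radialLimsup g p k < K)
    {ψ : 𝓢(Rn n, ℂ)} (hψ : eLpNorm ψ (2 * q) volume ≤ 1) :
    ∀ᶠ ε in 𝓝[>] 0, ‖mollifiedPairing g χ ε ψ‖ₑ ^ 2 ≤
      2 ^ (d + 2) * D * 2 ^ ((n - α + 1) * (1 - q⁻¹.toReal)) * B ^ (1 - q⁻¹.toReal) *
        K ^ (2 / p) := by
  have hτ : 0 ≤ 1 - q⁻¹.toReal :=
    sub_nonneg.2 (ENNReal.toReal_mono ENNReal.one_ne_top (ENNReal.inv_le_one.2 hq))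
  obtain ⟨L₀, hL₀⟩ := eventually_atTop.1 (eventually_lintegral_ball_enorm_sq_le hg.1 hp hk hK)
  filter_upwards [tendsto_inv_nhdsGT_zero.eventually_ge_atTop L₀,
    eventually_volume_thickening_le hB₀ hB hMB, self_mem_nhdsWithin] with ε hεL₀ hvol hε
  have hε : 0 < ε := hε
  set m : ℝ := (n - α) * (1 - q⁻¹.toReal)
  have hfreq : ∫⁻ ξ, ‖g ξ‖ₑ ^ 2 * ‖𝓕⁻ χ (ε • ξ)‖ₑ ^ 2 ≤
      2 ^ (d + 2) * D * K ^ (2 / p) * ENNReal.ofReal (ε ^ (-m)) :=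
    lintegral_mul_comp_smul_le (w := fun x => ‖𝓕⁻ χ x‖ₑ ^ 2) (hg.1.measurable.enorm.pow_const 2)
      hD hd hL₀ hε hεL₀
  have hspace : ∫⁻ x in Metric.thickening ε M, ‖ψ x‖ₑ ^ 2 ≤
      2 ^ ((n - α + 1) * (1 - q⁻¹.toReal)) * B ^ (1 - q⁻¹.toReal) * ENNReal.ofReal (ε ^ m) := by
    refine (setLIntegral_enorm_sq_le ψ.continuous.aestronglyMeasurable hq hψ _).trans
      ((ENNReal.rpow_le_rpow hvol hτ).trans_eq ?_)
    rw [ENNReal.mul_rpow_of_nonneg _ _ hτ, ENNReal.mul_rpow_of_nonneg _ _ hτ, ← ENNReal.rpow_mul,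
      ENNReal.ofReal_rpow_of_pos (by positivity), ← Real.rpow_mul hε.le]
  have hcancel : ENNReal.ofReal (ε ^ (-m)) * ENNReal.ofReal (ε ^ m) = 1 := by
    rw [← ENNReal.ofReal_mul (by positivity), ← Real.rpow_add hε, neg_add_cancel,
      Real.rpow_zero, ENNReal.ofReal_one]
  calc ‖mollifiedPairing g χ ε ψ‖ₑ ^ 2
      ≤ _ := enorm_mollifiedPairing_sq_le_thickening hM hu hg.1 (fun φ => (hg.2 φ).2) hχ hε ψ
    _ ≤ _ := mul_le_mul' hfreq hspace
    _ = 2 ^ (d + 2) * D * 2 ^ ((n - α + 1) * (1 - q⁻¹.toReal)) * B ^ (1 - q⁻¹.toReal) *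
          K ^ (2 / p) * (ENNReal.ofReal (ε ^ (-m)) * ENNReal.ofReal (ε ^ m)) := by ring
    _ = _ := by rw [hcancel, mul_one]

theorem exists_enorm_apply_rpow_le [NeZero n] (α : ℝ) (hq : 1 ≤ q) (hp : 2 ≤ p) {k : ℝ}
    (hk : (n - α) * (1 - q⁻¹.toReal) * (p / 2) = n * (p / 2 - 1) + k) :
    ∃ C : ℝ≥0, 0 < C ∧ ∀ {B : ℝ≥0∞} {M : Set (Rn n)} {u : 𝓢'(Rn n, ℂ)} {g : Rn n → ℂ}
      {ψ : 𝓢(Rn n, ℂ)}, B ≠ 0 → B ≠ ∞ → Bornology.IsBounded M → upperMinkowskiContent α M ≤ B →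
      dsupport u ⊆ M → IsFourierFunction u g → eLpNorm ψ (2 * q) volume ≤ 1 →
      ‖u ψ‖ₑ ^ p ≤ C * B ^ (p / 2 * (1 - q⁻¹.toReal)) * radialLimsup g p k := by
  obtain ⟨d, hd⟩ := exists_nat_ge ((n - α) * (1 - q⁻¹.toReal))
  obtain ⟨χ, hχ, hχ_one⟩ := exists_schwartz_fourierInv_zero_eq_one (Rn n)
  obtain ⟨D, hD₀, hD⟩ := exists_one_add_norm_pow_mul_enorm_sq_le (𝓕⁻ χ) (d + 1)
  let c : ℝ≥0 := 2 ^ (d + 2) * D * 2 ^ ((n - α + 1) * (1 - q⁻¹.toReal))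
  have hc : (c : ℝ≥0∞) = 2 ^ (d + 2) * D * 2 ^ ((n - α + 1) * (1 - q⁻¹.toReal)) := by
    simp [c, ENNReal.coe_rpow_of_ne_zero]
  have hp₀ : 0 ≤ p / 2 := by linarith
  refine ⟨c ^ (p / 2), by positivity, fun {B M u g ψ} hB₀ hB hM hMB hu hg hψ => ?_⟩
  rw [ENNReal.coe_rpow_of_nonneg _ hp₀, mul_comm (p / 2), ENNReal.rpow_mul,
    ← ENNReal.mul_rpow_of_nonneg _ _ hp₀]
  have hc₀ : (c : ℝ≥0∞) ≠ 0 := ENNReal.coe_ne_zero.2 (show 0 < c by positivity).ne'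
  have hbase : 0 < (c : ℝ≥0∞) * B ^ (1 - q⁻¹.toReal) :=
    ENNReal.mul_pos hc₀ (ENNReal.rpow_pos (pos_iff_ne_zero.2 hB₀) hB).ne'
  have hbase_top : (c : ℝ≥0∞) * B ^ (1 - q⁻¹.toReal) ≠ ∞ :=
    ENNReal.mul_ne_top ENNReal.coe_ne_top (ENNReal.rpow_ne_top_of_ne_zero hB₀ hB)
  refine ENNReal.le_mul_of_forall_lt (.inl (ENNReal.rpow_pos hbase hbase_top).ne')
    (.inl (ENNReal.rpow_ne_top_of_nonneg hp₀ hbase_top)) fun a ha K hK => ?_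
  have hlim := (tendsto_mollifiedPairing hg.1 hg.2 hχ_one ψ).mono_left
    (nhdsWithin_le_nhds (s := Ioi 0))
  have hsq : ‖u ψ‖ₑ ^ 2 ≤ c * B ^ (1 - q⁻¹.toReal) * K ^ (2 / p) :=
    le_of_tendsto (((ENNReal.continuous_pow 2).tendsto _).comp hlim.enorm) (hc ▸
      eventually_enorm_mollifiedPairing_sq_le hχ hD hd hq hp hk hM hu hg hB₀ hB hMB hK hψ)
  calc ‖u ψ‖ₑ ^ p = (‖u ψ‖ₑ ^ 2) ^ (p / 2) := by
        rw [← ENNReal.rpow_ofNat, ← ENNReal.rpow_mul, mul_div_cancel₀ p two_ne_zero]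
    _ ≤ (c * B ^ (1 - q⁻¹.toReal) * K ^ (2 / p)) ^ (p / 2) := by gcongr
    _ = (c * B ^ (1 - q⁻¹.toReal)) ^ (p / 2) * K := by
        rw [ENNReal.mul_rpow_of_nonneg _ _ hp₀, ← ENNReal.rpow_mul K,
          div_mul_div_cancel₀ (by linarith), div_self two_ne_zero, ENNReal.rpow_one]
    _ ≤ a * K := by gcongr

theorem exists_radialLimsup_le_mul_ballLimsup (n : ℕ) [NeZero n] (hp : 2 ≤ p) :
    ∃ S : ℝ≥0, 0 < S ∧ ∀ {g : Rn n → ℂ}, Continuous g → ∀ k,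
      radialLimsup g p k ≤ S * ballLimsup g p k := by
  have hsphere : 0 < (volume : Measure (Rn n)).toSphere univ :=
    Measure.measure_univ_pos.2 (Measure.toSphere_ne_zero _)
  have hS : (volume : Measure (Rn n)).toSphere univ ^ (p / 2 - 1) ≠ ∞ :=
    ENNReal.rpow_ne_top_of_nonneg (by linarith) (measure_ne_top _ _)
  refine ⟨((volume : Measure (Rn n)).toSphere univ ^ (p / 2 - 1)).toNNReal,
    ENNReal.toNNReal_pos (ENNReal.rpow_pos hsphere (measure_ne_top _ _)).ne' hS,
    fun {g} hg k => ?_⟩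
  rw [ENNReal.coe_toNNReal hS]
  exact radialLimsup_le_mul_ballLimsup hg hp k

end DualNorm

theorem theorem2p8_general (n : ℕ) [NeZero n] (α : ℝ) {q : ℝ≥0∞} (hq : 1 ≤ q) {p : ℝ}
    (hp : 2 ≤ p) :
    ∃ C C' : ℝ≥0, 0 < C ∧ 0 < C' ∧
      ∀ {B : ℝ≥0∞} {M : Set (Rn n)} {u : 𝓢'(Rn n, ℂ)}, B ≠ 0 → B ≠ ∞ → IsCompact M →
        upperMinkowskiContent α M ≤ B → Distribution.dsupport u ⊆ M →
        ∃ g : Rn n → ℂ, IsFourierFunction u g ∧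
          dualNorm u (2 * q) ^ p ≤
            C * B ^ (p / 2 * (1 - q⁻¹.toReal)) *
              radialLimsup g p (n - α * p / 2 - (n - α) * (p / 2 * q⁻¹.toReal)) ∧
          C * B ^ (p / 2 * (1 - q⁻¹.toReal)) *
              radialLimsup g p (n - α * p / 2 - (n - α) * (p / 2 * q⁻¹.toReal)) ≤
            C' * B ^ (p / 2 * (1 - q⁻¹.toReal)) *
              ballLimsup g p (n - α * p / 2 - (n - α) * (p / 2 * q⁻¹.toReal)) := by
  obtain ⟨C, hC, hdual⟩ := exists_enorm_apply_rpow_le (n := n)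
    (k := n - α * p / 2 - (n - α) * (p / 2 * q⁻¹.toReal)) α hq hp (by ring)
  obtain ⟨S, hS, hball⟩ := exists_radialLimsup_le_mul_ballLimsup n hp
  refine ⟨C, C * S, hC, mul_pos hC hS, fun {B M u} hB₀ hB hM hMB hu => ?_⟩
  obtain ⟨g, hg⟩ : ∃ g, IsFourierFunction u g := exists_continuous_fourier hM hu
  refine ⟨g, hg, ?_, ?_⟩
  · have hp₀ : 0 < p := by linarith
    rw [← ENNReal.le_rpow_inv_iff hp₀]
    refine iSup_le fun ψ => iSup_le fun _ => iSup_le fun hψ => ?_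
    rw [ENNReal.le_rpow_inv_iff hp₀]
    exact hdual hB₀ hB hM.isBounded hMB hu hg hψ
  · rw [ENNReal.coe_mul, mul_right_comm (C : ℝ≥0∞) S, mul_assoc _ (S : ℝ≥0∞)]
    exact mul_le_mul_right (hball hg.1 _) _

theorem MinkowskiBounded.upperMinkowskiContent_self {n : ℕ} {α : ℝ} {A : ℝ≥0} {M : Set (Rn n)}
    {μ : Measure (Rn n)} (h : MinkowskiBounded α A M μ) (hM : IsCompact M) (hμ : μ ≠ 0)
    (hMc : μ Mᶜ = 0) :
    upperMinkowskiContent α M ≠ 0 ∧ upperMinkowskiContent α M ≤ A * μ M := by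
  refine h M Subset.rfl hM fun hμM => hμ (Measure.measure_univ_eq_zero.1 ?_)
  rw [← union_compl_self M]
  exact measure_union_null hμM hMc

theorem theorem2p8 (n : ℕ) (α : ℝ) (hα : 0 < α) (hαn : α < n) :
    (∀ p : ℝ, 2 ≤ p → p < 2 * n / α →
      ∃ C C' : ℝ≥0, 0 < C ∧ 0 < C' ∧
        ∀ (A : ℝ≥0) (M : Set (Rn n)) (μ : Measure (Rn n)) (u : 𝓢'(Rn n, ℂ)),
          IsCompact M → IsFiniteMeasure μ → μ ≠ 0 → μ Mᶜ = 0 → MinkowskiBounded α A M μ →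
          Distribution.dsupport u ⊆ M →
          ∃ g : Rn n → ℂ, IsFourierFunction u g ∧
            dualNorm u ∞ ^ p ≤
              C * (A * μ M) ^ (p / 2) * radialLimsup g p (n - α * p / 2) ∧
            C * (A * μ M) ^ (p / 2) * radialLimsup g p (n - α * p / 2) ≤
              C' * (A * μ M) ^ (p / 2) * ballLimsup g p (n - α * p / 2)) ∧
    (∀ (q : ℝ≥0∞) (p : ℝ), 1 < q → 2 ≤ p → p < 2 * n / (α + (n - α) * q⁻¹.toReal) →
      ∃ C C' : ℝ≥0, 0 < C ∧ 0 < C' ∧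
        ∀ (A : ℝ≥0) (M : Set (Rn n)) (μ : Measure (Rn n)) (u : 𝓢'(Rn n, ℂ)),
          IsCompact M → IsFiniteMeasure μ → μ ≠ 0 → μ Mᶜ = 0 → MinkowskiBounded α A M μ →
          Distribution.dsupport u ⊆ M →
          ∃ g : Rn n → ℂ, IsFourierFunction u g ∧
            dualNorm u (2 * q) ^ p ≤
              C * (A * μ M) ^ (p / 2 * (1 - q⁻¹.toReal)) *
                radialLimsup g p (n - α * p / 2 - (n - α) * (p / 2 * q⁻¹.toReal)) ∧
            C * (A * μ M) ^ (p / 2 * (1 - q⁻¹.toReal)) *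
                radialLimsup g p (n - α * p / 2 - (n - α) * (p / 2 * q⁻¹.toReal)) ≤
              C' * (A * μ M) ^ (p / 2 * (1 - q⁻¹.toReal)) *
                ballLimsup g p (n - α * p / 2 - (n - α) * (p / 2 * q⁻¹.toReal))) := by
  have : NeZero n := ⟨by rintro rfl; exact (hα.trans hαn).ne' Nat.cast_zero⟩
  refine ⟨fun p hp _ => ?_, fun q p hq hp _ => ?_⟩
  · obtain ⟨C, C', hC, hC', hbound⟩ := theorem2p8_general n α le_top hp
    refine ⟨C, C', hC, hC', fun A M μ u hM _ hμ hMc hMB hu => ?_⟩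
    obtain ⟨hne, hle⟩ := hMB.upperMinkowskiContent_self hM hμ hMc
    simpa using hbound (ne_bot_of_le_ne_bot hne hle) (by finiteness) hM hle hu
  · obtain ⟨C, C', hC, hC', hbound⟩ := theorem2p8_general n α hq.le hp
    refine ⟨C, C', hC, hC', fun A M μ u hM _ hμ hMc hMB hu => ?_⟩
    obtain ⟨hne, hle⟩ := hMB.upperMinkowskiContent_self hM hμ hMc
    exact hbound (ne_bot_of_le_ne_bot hne hle) (by finiteness) hM hle hu
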